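/- Colour the edges of a graph arbitrarily (not necessarily properly). For a vertex $r$ of a graph $G$, let $\operatorname{Aut}(G,r)$ be the group of automorphisms of $G$ that fix $r$. An edge colouring $c$ of the rooted graph $(G,r)$ is *distinguishing* if the identity is the only $\varphi\in\operatorname{Aut}(G,r)$ with $c(\varphi(e))=c(e)$ for every edge $e$. Two edge colourings $c,d$ of $(G,r)$ are *non-isomorphic* if for every $\varphi\in\operatorname{Aut}(G,r)$ there is an edge $e$ with $c(e)\neq d(\varphi(e))$. A graph is *$K_{1,n}$-free* if none of its induced subgraphs is isomorphic to $K_{1,n}$. The *hourglass* is the graph obtained by gluing two triangles at a common vertex, which is called its central vertex. **Theorem.** Let $n>2$ be a natural number, and let $r$ be a vertex of a connected finite simple $K_{1,n}$-free graph $G$. Then at least one of the following holds: 1. there exist at least $n-1$ pairwise non-isomorphic distinguishing edge colourings of the rooted graph $(G,r)$ with colours from the fixed set $\{1,\dots,n-1\}$; 2. $n=3$, $G$ is isomorphic to the hourglass, and $r$ is the central vertex of $G$; 3. $G\cong K_{1,n-1}$, and $r$ is the central vertex of $G$; 4. $G\cong K_1$. -/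

import Mathlib

namespace SimpleGraph

/-- The star `K_{1,m}`; its central vertex is `Sum.inl 0`. -/
abbrev starK (m : ℕ) : SimpleGraph (Fin 1 ⊕ Fin m) :=
  completeBipartiteGraph (Fin 1) (Fin m)

/-- `G` is `H`-free: no induced subgraph of `G` is isomorphic to `H`. -/
def IsIndFree {V W : Type*} (H : SimpleGraph W) (G : SimpleGraph V) : Prop :=
  ¬ H.IsIndContained G

/-- The hourglass: the triangles `{0, 1, 2}` and `{0, 3, 4}` glued at the vertex `0`,
which is the central vertex (the only one of degree four). -/
def hourglass : SimpleGraph (Fin 5) :=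
  fromEdgeSet {s(0, 1), s(0, 2), s(1, 2), s(0, 3), s(0, 4), s(3, 4)}

/-- The automorphism group `Aut(G, r)` of the rooted graph `(G, r)`. -/
def rootedAut {V : Type*} (G : SimpleGraph V) (r : V) : Subgroup (G ≃g G) where
  carrier := {φ | φ r = r}
  mul_mem' {φ ψ} hφ hψ := by
    change φ (ψ r) = r
    rw [show ψ r = r from hψ]
    exact hφ
  one_mem' := rfl
  inv_mem' {φ} hφ := by
    change φ.symm r = r
    rw [RelIso.symm_apply_eq]
    exact (show φ r = r from hφ).symm

/-- An edge colouring `c` of the rooted graph `(G, r)` is distinguishing if the only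
automorphism of `(G, r)` that preserves `c` is the identity. -/
def IsDistinguishing {V K : Type*} {G : SimpleGraph V} (r : V) (c : G.EdgeLabeling K) : Prop :=
  ∀ φ ∈ G.rootedAut r, (∀ e : G.edgeSet, c (φ.mapEdgeSet e) = c e) → φ = 1

/-- Two edge colourings `c`, `d` of the rooted graph `(G, r)` are non-isomorphic if no
automorphism of `(G, r)` carries one to the other. -/
def NonIsomorphic {V K : Type*} {G : SimpleGraph V} (r : V) (c d : G.EdgeLabeling K) : Prop :=
  ∀ φ ∈ G.rootedAut r, ∃ e : G.edgeSet, c e ≠ d (φ.mapEdgeSet e)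

end SimpleGraph

/-! Put k = n - 1. Being K_{1,n}-free means that no neighbourhood contains k + 1 independent
vertices. This passes to induced subgraphs, so `rich_or_exceptional` can induct on the number of
vertices over all connected `G[S]` and all choices of root.

If r is not a cut vertex, delete it and re-root at a neighbour x. Giving rx a colour that no other
edge at r has forces x to be fixed, so a rigid family for `(G[S \ {r}], x)` lifts to `(G[S], r)`
(`rigid_glue`). A suitable x exists: if x is the only neighbour of r and `G[S \ {r}]` is exceptional
at x, then r and k independent neighbours of x are k + 1 independent neighbours of x. If r has
several neighbours, use that a graph is exceptional at no more than one root. A one-vertex remainder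
is treated directly.

If r is a cut vertex, split `G[S]` into branches: a component of `G[S \ {r}]` together with r. There
are at most k of them, and r is not a cut vertex of any. Suppose every branch has N colourings,
chosen consistently on isomorphic branches. Giving the branches distinct indices below N prevents
permuting them, and the set of indices used is an invariant of the colouring (`rich_of_components`).
With q branches, 0 < q < N, there are binom(N, q) ≥ N such sets.

For N = k the count fails only when q = k. Then the neighbours of r in each branch form a clique,
and this is why `rich_of_connOn_diff` produces k + 1 colourings under that assumption. Its
exceptions are a branch that is a single edge or, for k = 2, a triangle. If some but not all
branches resemble an exceptional one, the count is applied to those alone. If all do, the graph is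
the star or the hourglass. -/

namespace SimpleGraph

/-! ### Partial isomorphisms, rigid families, reachability and the exceptional graphs. -/

section Basic

variable {V : Type*} {G : SimpleGraph V} {K : Type*}

/-- The permutation `φ` restricts to an isomorphism from `G[S]` to `G[T]`. -/
def IsoOn (G : SimpleGraph V) (S T : Set V) (φ : Equiv.Perm V) : Prop :=
  (∀ v, φ v ∈ T ↔ v ∈ S) ∧ ∀ u ∈ S, ∀ v ∈ S, G.Adj (φ u) (φ v) ↔ G.Adj u v

/-- The permutation `φ` carries the colouring `c` of the edges of `G[S]` to the colouring `d`. -/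
def CarriesOn (G : SimpleGraph V) (S : Set V) (c d : Sym2 V → K) (φ : Equiv.Perm V) : Prop :=
  ∀ u ∈ S, ∀ v ∈ S, G.Adj u v → d s(φ u, φ v) = c s(u, v)

/-- The colourings `c i`, `i < M`, of the rooted graph `(G[S], r)` are distinguishing and pairwise
non-isomorphic. -/
def Rigid (G : SimpleGraph V) (S : Set V) (r : V) (c : ℕ → Sym2 V → K) (M : ℕ) : Prop :=
  ∀ i < M, ∀ j < M, ∀ φ : Equiv.Perm V, IsoOn G S S φ → φ r = r → CarriesOn G S (c i) (c j) φ →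
    i = j ∧ ∀ v ∈ S, φ v = v

/-- The rooted graph `(G[S], r)` has `M` pairwise non-isomorphic distinguishing edge colourings with
colours from `K`. -/
def Rich (G : SimpleGraph V) (K : Type*) (S : Set V) (r : V) (M : ℕ) : Prop :=
  ∃ c : ℕ → Sym2 V → K, Rigid G S r c M

lemma IsoOn.symm {S T : Set V} {φ : Equiv.Perm V} (h : IsoOn G S T φ) : IsoOn G T S φ⁻¹ := by
  have h1 : ∀ v, φ⁻¹ v ∈ S ↔ v ∈ T := fun v => by rw [← h.1]; simp
  refine ⟨h1, fun u hu v hv => ?_⟩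
  rw [← h.2 _ ((h1 u).2 hu) _ ((h1 v).2 hv)]; simp

lemma IsoOn.trans {S T U : Set V} {φ ψ : Equiv.Perm V} (h : IsoOn G S T φ) (h' : IsoOn G T U ψ) :
    IsoOn G S U (ψ * φ) :=
  ⟨fun v => (h'.1 _).trans (h.1 v), fun u hu v hv =>
    (h'.2 _ ((h.1 u).2 hu) _ ((h.1 v).2 hv)).trans (h.2 u hu v hv)⟩

lemma IsoOn.refl (S : Set V) : IsoOn G S S 1 := ⟨fun _ => Iff.rfl, fun _ _ _ _ => Iff.rfl⟩

lemma IsoOn.restrict {S T S' T' : Set V} {φ : Equiv.Perm V} (h : IsoOn G S T φ) (hS : S' ⊆ S)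
    (hT : ∀ v, φ v ∈ T' ↔ v ∈ S') : IsoOn G S' T' φ :=
  ⟨hT, fun u hu v hv => h.2 u (hS hu) v (hS hv)⟩

lemma CarriesOn.mono {S S' : Set V} {c d : Sym2 V → K} {φ : Equiv.Perm V}
    (h : CarriesOn G S c d φ) (hS : S' ⊆ S) : CarriesOn G S' c d φ :=
  fun u hu v hv => h u (hS hu) v (hS hv)

lemma CarriesOn.symm {S T : Set V} {c d : Sym2 V → K} {φ : Equiv.Perm V} (hφ : IsoOn G S T φ)
    (h : CarriesOn G S c d φ) : CarriesOn G T d c φ⁻¹ := by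
  intro u hu v hv huv
  have := h _ ((hφ.symm.1 u).2 hu) _ ((hφ.symm.1 v).2 hv) ((hφ.symm.2 u hu v hv).2 huv)
  simpa using this.symm

lemma CarriesOn.trans {S T : Set V} {c d e : Sym2 V → K} {φ ψ : Equiv.Perm V}
    (hφ : IsoOn G S T φ) (h : CarriesOn G S c d φ) (h' : CarriesOn G T d e ψ) :
    CarriesOn G S c e (ψ * φ) := by
  intro u hu v hv huv
  rw [← h u hu v hv huv]
  exact h' _ ((hφ.1 u).2 hu) _ ((hφ.1 v).2 hv) ((hφ.2 u hu v hv).2 huv)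

lemma Rich.mono {S : Set V} {r : V} {M M' : ℕ} (h : Rich G K S r M) (hM : M' ≤ M) :
    Rich G K S r M' := by
  obtain ⟨c, hc⟩ := h
  exact ⟨c, fun i hi j hj => hc i (hi.trans_le hM) j (hj.trans_le hM)⟩

/-- A rigid family can be extended by one more colouring. -/
lemma Rigid.append {S : Set V} {r : V} {c : ℕ → Sym2 V → K} {M : ℕ} (hc : Rigid G S r c M)
    (e : Sym2 V → K)
    (he : ∀ φ, IsoOn G S S φ → φ r = r → CarriesOn G S e e φ → ∀ v ∈ S, φ v = v)
    (hce : ∀ i < M, ∀ φ, IsoOn G S S φ → φ r = r → ¬ CarriesOn G S e (c i) φ) :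
    Rich G K S r (M + 1) := by
  refine ⟨fun i => if i = M then e else c i, fun i hi j hj φ h1 h2 h3 => ?_⟩
  by_cases hiM : i = M <;> by_cases hjM : j = M
  · simp only [hiM, hjM, if_true] at h3 ⊢
    exact ⟨trivial, he φ h1 h2 h3⟩
  · simp only [hiM, hjM, if_true, if_false] at h3
    exact absurd h3 (hce j (by omega) φ h1 h2)
  · simp only [hiM, hjM, if_true, if_false] at h3
    exact absurd (h3.symm h1) (hce i (by omega) _ h1.symm (by rw [Equiv.Perm.inv_eq_iff_eq, h2]))
  · simp only [hiM, hjM, if_false] at h3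
    exact hc i (by omega) j (by omega) φ h1 h2 h3

open Classical in
/-- The edge colouring with colour `f v` on the edge `rv` that agrees with `d` off `r`. -/
noncomputable def glue (r : V) (f : V → K) (d : Sym2 V → K) : Sym2 V → K :=
  Sym2.lift ⟨fun u v => if u = r then f v else if v = r then f u else d s(u, v), fun u v => by
    by_cases hu : u = r <;> by_cases hv : v = r <;> simp [hu, hv, Sym2.eq_swap]⟩

@[simp] lemma glue_root (r : V) (f : V → K) (d : Sym2 V → K) (v : V) : glue r f d s(r, v) = f v := by
  simp [glue]

lemma glue_of_ne {r : V} (f : V → K) (d : Sym2 V → K) {u v : V} (hu : u ≠ r) (hv : v ≠ r) :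
    glue r f d s(u, v) = d s(u, v) := by
  simp [glue, hu, hv]

lemma apply_ne {φ : Equiv.Perm V} {r v : V} (hr : φ r = r) (hv : v ≠ r) : φ v ≠ r := fun h =>
  hv (φ.injective (h.trans hr.symm))

lemma apply_eq_iff {φ : Equiv.Perm V} {r v : V} (hr : φ r = r) : φ v = r ↔ v = r :=
  ⟨fun h => φ.injective (h.trans hr.symm), fun h => h ▸ hr⟩

lemma IsoOn.diff_root {S : Set V} {φ : Equiv.Perm V} {r : V} (h : IsoOn G S S φ) (hr : φ r = r) :
    IsoOn G (S \ {r}) (S \ {r}) φ :=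
  h.restrict Set.sdiff_subset fun v => by
    simp only [Set.mem_sdiff, Set.mem_singleton_iff, h.1 v, apply_eq_iff hr]

lemma CarriesOn.of_glue {S : Set V} {φ : Equiv.Perm V} {r : V} {f g : V → K} {c d : Sym2 V → K}
    (hr : φ r = r) (h : CarriesOn G S (glue r f c) (glue r g d) φ) :
    CarriesOn G (S \ {r}) c d φ := by
  rintro u ⟨hu, hur⟩ v ⟨hv, hvr⟩ huv
  have := h u hu v hv huv
  rwa [glue_of_ne _ _ hur hvr, glue_of_ne _ _ (apply_ne hr hur) (apply_ne hr hvr)] at this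

lemma CarriesOn.root_of_glue {S : Set V} {φ : Equiv.Perm V} {r : V} {f g : V → K}
    {c d : Sym2 V → K} (hrS : r ∈ S)
    (hr : φ r = r) (h : CarriesOn G S (glue r f c) (glue r g d) φ) {v : V} (hv : v ∈ S)
    (hrv : G.Adj r v) : g (φ v) = f v := by
  have := h r hrS v hv hrv
  rwa [hr, glue_root, glue_root] at this

/-- Extending a rigid family from `S \ {r}` rooted at `r'` to `S` rooted at `r`. -/
lemma Rigid.extend {S : Set V} {r r' : V} (hrS : r ∈ S) {d : ℕ → Sym2 V → K} {k M : ℕ}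
    (hd : Rigid G (S \ {r}) r' d k) (f : ℕ → V → K) (t : ℕ → ℕ) (ht : ∀ a < M, t a < k)
    (H : ∀ a < M, ∀ b < M, ∀ φ, IsoOn G S S φ → φ r = r →
      (∀ v ∈ S, G.Adj r v → f b (φ v) = f a v) → φ r' = r' ∧ (t a = t b → a = b)) :
    Rigid G S r (fun a => glue r (f a) (d (t a))) M := by
  intro a ha b hb φ h1 h2 h3
  obtain ⟨h4, h5⟩ := H a ha b hb φ h1 h2 fun v hv hrv => h3.root_of_glue hrS h2 hv hrv
  obtain ⟨h6, h7⟩ := hd _ (ht a ha) _ (ht b hb) φ (h1.diff_root h2) h4 (h3.of_glue h2)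
  refine ⟨h5 h6, fun v hv => ?_⟩
  by_cases hvr : v = r
  · rw [hvr, h2]
  · exact h7 v ⟨hv, hvr⟩

/-- Reachability within `S`. -/
def ReachIn (G : SimpleGraph V) (S : Set V) : V → V → Prop :=
  Relation.ReflTransGen fun u v => G.Adj u v ∧ u ∈ S ∧ v ∈ S

lemma ReachIn.refl {S : Set V} (u : V) : ReachIn G S u u := Relation.ReflTransGen.refl

lemma ReachIn.of_adj {S : Set V} {u v : V} (h : G.Adj u v) (hu : u ∈ S) (hv : v ∈ S) :
    ReachIn G S u v := Relation.ReflTransGen.single ⟨h, hu, hv⟩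

lemma ReachIn.trans {S : Set V} {u v w : V} (h : ReachIn G S u v) (h' : ReachIn G S v w) :
    ReachIn G S u w := Relation.ReflTransGen.trans h h'

lemma ReachIn.symm {S : Set V} {u v : V} (h : ReachIn G S u v) : ReachIn G S v u := by
  induction h with
  | refl => exact .refl _
  | tail _ h ih => exact (ReachIn.of_adj h.1.symm h.2.2 h.2.1).trans ih

lemma ReachIn.mono {S T : Set V} (hST : S ⊆ T) {u v : V} (h : ReachIn G S u v) :
    ReachIn G T u v := by
  induction h with
  | refl => exact .refl _
  | tail _ h ih => exact ih.trans (.of_adj h.1 (hST h.2.1) (hST h.2.2))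

lemma ReachIn.mem_of_closed {S A : Set V} (hA : ∀ a ∈ A, ∀ b ∈ S, G.Adj a b → b ∈ A) {u v : V}
    (h : ReachIn G S u v) (hu : u ∈ A) : v ∈ A := by
  induction h with
  | refl => exact hu
  | tail _ h ih => exact hA _ ih _ h.2.2 h.1

lemma ReachIn.mem {S : Set V} {u v : V} (h : ReachIn G S u v) (hu : u ∈ S) : v ∈ S :=
  h.mem_of_closed (fun _ _ _ hb _ => hb) hu

/-- A path inside `S` stays inside every subset of `S` containing its start and closed in `S`. -/
lemma ReachIn.restrict {S A : Set V} (hA : ∀ a ∈ A, ∀ b ∈ S, G.Adj a b → b ∈ A)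
    {u v : V} (h : ReachIn G S u v) (hu : u ∈ A) : ReachIn G A u v := by
  induction h with
  | refl => exact .refl _
  | tail h' h ih =>
    have := ReachIn.mem_of_closed hA h' hu
    exact ih.trans (.of_adj h.1 this (hA _ this _ h.2.2 h.1))

lemma ReachIn.map {S T : Set V} {φ : Equiv.Perm V} (hφ : IsoOn G S T φ) {u v : V}
    (h : ReachIn G S u v) : ReachIn G T (φ u) (φ v) := by
  induction h with
  | refl => exact .refl _
  | tail _ h ih =>
    exact ih.trans (.of_adj ((hφ.2 _ h.2.1 _ h.2.2).2 h.1) ((hφ.1 _).2 h.2.1) ((hφ.1 _).2 h.2.2))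

lemma ReachIn.map_iff {S T : Set V} {φ : Equiv.Perm V} (hφ : IsoOn G S T φ) {u v : V} :
    ReachIn G T (φ u) (φ v) ↔ ReachIn G S u v :=
  ⟨fun h => by simpa using h.map hφ.symm, fun h => h.map hφ⟩

/-- The induced subgraph on `S` is connected. -/
def ConnOn (G : SimpleGraph V) (S : Set V) : Prop :=
  S.Nonempty ∧ ∀ u ∈ S, ∀ v ∈ S, ReachIn G S u v

lemma ConnOn.mem_of_closed {S A : Set V} (h : ConnOn G S) {a : V} (haS : a ∈ S) (ha : a ∈ A)
    (hA : ∀ a ∈ A, ∀ b ∈ S, G.Adj a b → b ∈ A) {v : V} (hv : v ∈ S) : v ∈ A :=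
  (h.2 a haS v hv).mem_of_closed hA ha

lemma connOn_of_root {S : Set V} {x : V} (hx : x ∈ S) (h : ∀ v ∈ S, ReachIn G S x v) :
    ConnOn G S :=
  ⟨⟨x, hx⟩, fun u hu v hv => (h u hu).symm.trans (h v hv)⟩

/-- Neighbourhoods contain at most `k` pairwise nonadjacent vertices. -/
def LocallyIndepLE (G : SimpleGraph V) (k : ℕ) : Prop :=
  ∀ v (I : Finset V), (∀ x ∈ I, G.Adj v x) → (∀ x ∈ I, ∀ y ∈ I, ¬ G.Adj x y) → I.card ≤ k

/-- `G[S]` is a star with `k` leaves and centre `r`. -/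
def StarAt (G : SimpleGraph V) (k : ℕ) (S : Set V) (r : V) : Prop :=
  (S \ {r}).ncard = k ∧ (∀ v ∈ S, v ≠ r → G.Adj r v) ∧
    ∀ u ∈ S, ∀ v ∈ S, u ≠ r → v ≠ r → ¬ G.Adj u v

/-- `G[S]` is an hourglass with central vertex `r`. -/
def HourglassAt (G : SimpleGraph V) (S : Set V) (r : V) : Prop :=
  ∃ a b c d, a ≠ c ∧ a ≠ d ∧ b ≠ c ∧ b ≠ d ∧ S = {r, a, b, c, d} ∧
    G.Adj r a ∧ G.Adj r b ∧ G.Adj r c ∧ G.Adj r d ∧ G.Adj a b ∧ G.Adj c d ∧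
    ¬ G.Adj a c ∧ ¬ G.Adj a d ∧ ¬ G.Adj b c ∧ ¬ G.Adj b d

/-- The exceptional rooted graphs on at least two vertices. -/
def Exceptional (G : SimpleGraph V) (k : ℕ) (S : Set V) (r : V) : Prop :=
  StarAt G k S r ∨ (k = 2 ∧ HourglassAt G S r)

lemma Exceptional.adj {k : ℕ} {S : Set V} {r : V} (h : Exceptional G k S r) {v : V} (hv : v ∈ S)
    (hvr : v ≠ r) : G.Adj r v := by
  obtain h | ⟨-, a, b, c, d, -, -, -, -, rfl, h1, h2, h3, h4, -⟩ := h
  · exact h.2.1 v hv hvr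
  · rcases hv with rfl | rfl | rfl | rfl | rfl <;> first | assumption | exact absurd rfl hvr

lemma Exceptional.exists_not_adj [Finite V] {k : ℕ} (hk : 2 ≤ k) {S : Set V} {r : V}
    (h : Exceptional G k S r) {y : V} (hy : y ∈ S) (hyr : y ≠ r) :
    ∃ z ∈ S, z ≠ y ∧ ¬ G.Adj y z := by
  obtain h | ⟨-, a, b, c, d, hac, had, hbc, hbd, rfl, h1, h2, h3, h4, h5, h6, h7, h8, h9, h10⟩ := h
  · obtain ⟨z, hz, hzy⟩ := Set.exists_ne_of_one_lt_ncard (by rw [h.1]; omega : 1 < (S \ {r}).ncard) y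
    exact ⟨z, hz.1, hzy, h.2.2 y hy z hz.1 hyr hz.2⟩
  · rcases hy with rfl | rfl | rfl | rfl | rfl
    · exact absurd rfl hyr
    · exact ⟨c, by simp, hac.symm, h7⟩
    · exact ⟨c, by simp, hbc.symm, h9⟩
    · exact ⟨a, by simp, hac, fun h => h7 h.symm⟩
    · exact ⟨a, by simp, had, fun h => h8 h.symm⟩

lemma Exceptional.exists_indep [Finite V] {k : ℕ} {S : Set V} {r : V}
    (h : Exceptional G k S r) :
    ∃ I : Finset V, I.card = k ∧ (∀ x ∈ I, x ∈ S ∧ G.Adj r x) ∧ ∀ x ∈ I, ∀ y ∈ I, ¬ G.Adj x y := by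
  classical
  obtain h | ⟨rfl, a, b, c, d, hac, had, hbc, hbd, rfl, h1, h2, h3, h4, h5, h6, h7, -⟩ := h
  · refine ⟨(Set.toFinite (S \ {r})).toFinset, ?_, ?_, ?_⟩
    · rw [← Set.ncard_eq_toFinset_card, h.1]
    · intro x hx
      simp only [Set.Finite.mem_toFinset] at hx
      exact ⟨hx.1, h.2.1 x hx.1 hx.2⟩
    · intro x hx y hy
      simp only [Set.Finite.mem_toFinset] at hx hy
      exact h.2.2 x hx.1 y hy.1 hx.2 hy.2
  · refine ⟨{a, c}, Finset.card_pair hac, ?_, ?_⟩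
    · simp [h1, h3]
    · simp [h7, G.adj_comm c a]

end Basic

end SimpleGraph

namespace SimpleGraph

/-! ### Two colours, root of degree two: a colouring that does not separate the root edges. -/

section ConnectedCase

variable {V : Type*} {G : SimpleGraph V} {K : Type*}

/-- The root of an exceptional graph has k ≥ 2 independent neighbours. -/
lemma not_exceptional_of_clique [Finite V] {k : ℕ} (hk : 2 ≤ k) {S : Set V} {r : V}
    (h : ∀ u ∈ S, ∀ v ∈ S, G.Adj r u → G.Adj r v → u ≠ v → G.Adj u v) :
    ¬ Exceptional G k S r := by
  intro hE
  obtain ⟨I, hI, h1, h2⟩ := hE.exists_indep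
  obtain ⟨u, hu, v, hv, huv⟩ := Finset.one_lt_card.1 (by omega : 1 < I.card)
  exact h2 u hu v hv (h u (h1 u hu).1 v (h1 v hv).1 (h1 u hu).2 (h1 v hv).2 huv)

/-- The vertices of `W` reachable within `W` from the neighbours of `p`. -/
def reachSet (G : SimpleGraph V) (W : Set V) (p : V) : Set V :=
  {v | ∃ a ∈ W, G.Adj p a ∧ ReachIn G W a v}

lemma reachSet_subset (W : Set V) (p : V) : reachSet G W p ⊆ W := by
  rintro v ⟨a, ha, -, hav⟩
  exact hav.mem ha

lemma mem_reachSet_of_adj {W : Set V} {p a : V} (ha : a ∈ W) (hpa : G.Adj p a) :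
    a ∈ reachSet G W p := ⟨a, ha, hpa, .refl _⟩

lemma reachSet_closed (W : Set V) (p : V) :
    ∀ a ∈ reachSet G W p, ∀ b ∈ W, G.Adj a b → b ∈ reachSet G W p := by
  rintro v ⟨a, ha, hpa, hav⟩ b hb hvb
  exact ⟨a, ha, hpa, hav.trans (.of_adj hvb (hav.mem ha) hb)⟩

lemma connOn_insert_reachSet (W : Set V) (p : V) : ConnOn G (insert p (reachSet G W p)) := by
  refine connOn_of_root (Set.mem_insert _ _) fun v hv => ?_
  obtain rfl | ⟨a, ha, hpa, hav⟩ := hv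
  · exact .refl _
  · have haR := mem_reachSet_of_adj ha hpa
    exact (ReachIn.of_adj hpa (Set.mem_insert _ _) (Set.mem_insert_of_mem _ haR)).trans
      ((hav.restrict (reachSet_closed W p) haR).mono (Set.subset_insert _ _))

lemma map_mem_reachSet {S W : Set V} {φ : Equiv.Perm V} (hS : IsoOn G S S φ)
    (hW : IsoOn G W W φ) (hWS : W ⊆ S) {p : V} (hp : p ∈ S) {v : V} :
    φ v ∈ reachSet G W (φ p) ↔ v ∈ reachSet G W p := by
  constructor
  · rintro ⟨a, ha, hpa, hav⟩
    have ha' := (hW.symm.1 a).2 ha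
    refine ⟨φ⁻¹ a, ha', ?_, ?_⟩
    · rw [← hS.2 _ hp _ (hWS ha')]; simpa using hpa
    · rw [← ReachIn.map_iff hW]; simpa using hav
  · rintro ⟨a, ha, hpa, hav⟩
    exact ⟨φ a, (hW.1 a).2 ha, (hS.2 p hp a (hWS ha)).2 hpa, hav.map hW⟩

/-- In a claw-free rooted graph whose root has exactly two neighbours, which are adjacent and have
further neighbours, there is a distinguishing colouring in which both edges at the root have the
same colour. -/
lemma exists_distinguishing_of_two_neighbors [Finite V] (hL : LocallyIndepLE G 2) {S : Set V}
    {r x y : V} (hr : r ∈ S) (hx : x ∈ S) (hy : y ∈ S) (hxy : G.Adj x y)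
    (hN : ∀ v ∈ S, G.Adj r v ↔ v = x ∨ v = y) (hT : ConnOn G (S \ {r}))
    (hA : ∃ a ∈ S, G.Adj x a ∧ a ≠ r ∧ a ≠ y) (hB : ∃ b ∈ S, G.Adj y b ∧ b ≠ r ∧ b ≠ x)
    (IH : ∀ (S' : Set V) (r' : V), S'.ncard < S.ncard → r' ∈ S' → ConnOn G S' →
      Rich G (Fin 2) S' r' 2 ∨ S' = {r'} ∨ Exceptional G 2 S' r') :
    ∃ d : Sym2 V → Fin 2, ∀ φ, IsoOn G S S φ → φ r = r →
      CarriesOn G S (glue r (fun _ => 0) d) (glue r (fun _ => 0) d) φ → ∀ v ∈ S, φ v = v := by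
  classical
  have hrx : G.Adj r x := (hN x hx).2 (Or.inl rfl)
  have hry : G.Adj r y := (hN y hy).2 (Or.inr rfl)
  obtain ⟨a₀, ha₀S, hxa₀, ha₀r, ha₀y⟩ := hA
  obtain ⟨b₀, hb₀S, hyb₀, hb₀r, hb₀x⟩ := hB
  set W : Set V := {v | v ∈ S ∧ v ≠ r ∧ v ≠ x ∧ v ≠ y} with hW
  have hWS : W ⊆ S := fun v hv => hv.1
  have ha₀ : a₀ ∈ W := ⟨ha₀S, ha₀r, hxa₀.ne', ha₀y⟩
  have hb₀ : b₀ ∈ W := ⟨hb₀S, hb₀r, hb₀x, hyb₀.ne'⟩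
  have hrW : ∀ v ∈ W, ¬ G.Adj r v := fun v hv h => ((hN v hv.1).1 h).elim hv.2.2.1 hv.2.2.2
  have clique : ∀ p, G.Adj r p → ∀ a ∈ W, ∀ b ∈ W, G.Adj p a → G.Adj p b → a ≠ b →
      G.Adj a b := by
    intro p hp a ha b hb hpa hpb hab
    by_contra hnab
    -- Otherwise r, a, b are the leaves of a claw centred at p.
    have h3 : ({r, a, b} : Finset V).card = 3 :=
      Finset.card_eq_three.2 ⟨r, a, b, ha.2.1.symm, hb.2.1.symm, hab, rfl⟩
    have := hL p {r, a, b} (by simp [hp.symm, hpa, hpb]) (by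
      simp [hrW a ha, hrW b hb, hnab, G.adj_comm a r, G.adj_comm b r, G.adj_comm b a])
    omega
  have swap : ∀ φ : Equiv.Perm V, IsoOn G S S φ → φ r = r →
      (φ x = x ∧ φ y = y) ∨ (φ x = y ∧ φ y = x) := by
    intro φ h1 h2
    have key : ∀ p ∈ S, G.Adj r p → φ p = x ∨ φ p = y := fun p hp hrp => by
      rw [← hN _ ((h1.1 p).2 hp)]
      have := (h1.2 r hr p hp).2 hrp
      rwa [h2] at this
    have hne : φ x ≠ φ y := fun h => hxy.ne (φ.injective h)
    rcases key x hx hrx with h | h <;> rcases key y hy hry with h' | h'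
    · exact absurd (h.trans h'.symm) hne
    · exact Or.inl ⟨h, h'⟩
    · exact Or.inr ⟨h, h'⟩
    · exact absurd (h.trans h'.symm) hne
  have isoW : ∀ φ : Equiv.Perm V, IsoOn G S S φ → φ r = r → IsoOn G W W φ := by
    intro φ h1 h2
    refine h1.restrict hWS fun v => ?_
    have e1 : φ v = r ↔ v = r := apply_eq_iff h2
    have e2 : (φ v = x ∨ φ v = y) ↔ (v = x ∨ v = y) := by
      rcases swap φ h1 h2 with ⟨h3, h4⟩ | ⟨h3, h4⟩
      · rw [apply_eq_iff h3, apply_eq_iff h4]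
      · constructor
        · rintro (h | h)
          · exact Or.inr (φ.injective (h.trans h4.symm))
          · exact Or.inl (φ.injective (h.trans h3.symm))
        · rintro (rfl | rfl)
          · exact Or.inr h3
          · exact Or.inl h4
    simp only [hW, Set.mem_ofPred_eq, h1.1 v]
    tauto
  have cover : ∀ v ∈ W, v ∈ reachSet G W x ∨ v ∈ reachSet G W y := by
    intro v hv
    have : v ∈ {v | v = x ∨ v = y ∨ v ∈ reachSet G W x ∨ v ∈ reachSet G W y} := by
      refine hT.mem_of_closed (a := x) ⟨hx, hrx.ne'⟩ (Or.inl rfl) ?_ ⟨hv.1, hv.2.1⟩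
      intro a ha b hb hab
      by_cases hbx : b = x
      · exact Or.inl hbx
      by_cases hby : b = y
      · exact Or.inr (Or.inl hby)
      have hbW : b ∈ W := ⟨hb.1, hb.2, hbx, hby⟩
      rcases ha with rfl | rfl | ha | ha
      · exact Or.inr (Or.inr (Or.inl (mem_reachSet_of_adj hbW hab)))
      · exact Or.inr (Or.inr (Or.inr (mem_reachSet_of_adj hbW hab)))
      · exact Or.inr (Or.inr (Or.inl (reachSet_closed _ _ a ha b hbW hab)))
      · exact Or.inr (Or.inr (Or.inr (reachSet_closed _ _ a ha b hbW hab)))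
    rcases this with h | h | h
    · exact absurd h hv.2.2.1
    · exact absurd h hv.2.2.2
    · exact h
  have cliqueRich : ∀ p, G.Adj r p → ∀ S' : Set V, S' ⊆ S \ {r} → (∀ v ∈ S', G.Adj p v → v ∈ W) →
      ConnOn G S' → p ∈ S' → (∃ v ∈ S', v ≠ p) → Rich G (Fin 2) S' p 2 := by
    intro p hp S' hS' hpW hc hpS' ⟨v, hv, hvp⟩
    have hlt : S'.ncard < S.ncard := Set.ncard_lt_ncard
      ⟨fun v hv => (hS' hv).1, fun h => (hS' (h hr)).2 rfl⟩
    rcases IH S' p hlt hpS' hc with h | h | h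
    · exact h
    · rw [h] at hv; exact absurd hv hvp
    · exact absurd h (not_exceptional_of_clique le_rfl fun u hu v hv hpu hpv =>
        clique p hp u (hpW u hu hpu) v (hpW v hv hpv) hpu hpv)
  -- Either x and y stay linked through `W`, or removing r and the edge xy separates them.
  by_cases hcase : ∃ v, v ∈ reachSet G W x ∧ v ∈ reachSet G W y
  · obtain ⟨v, ⟨a, haW, hxa, hav⟩, b, hbW, hyb, hbv⟩ := hcase
    set S₂ : Set V := (S \ {r}) \ {x} with hS₂
    have hWS₂ : W ⊆ S₂ := fun v hv => ⟨⟨hv.1, hv.2.1⟩, hv.2.2.1⟩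
    have hyS₂ : y ∈ S₂ := ⟨⟨hy, hry.ne'⟩, hxy.ne'⟩
    have hyB : ∀ c ∈ W, G.Adj y c → ReachIn G S₂ y c := fun c hc hyc =>
      .of_adj hyc hyS₂ (hWS₂ hc)
    have hconn : ConnOn G S₂ := by
      refine connOn_of_root hyS₂ fun w hw => ?_
      by_cases hwy : w = y
      · rw [hwy]; exact .refl _
      have hwW : w ∈ W := ⟨hw.1.1, hw.1.2, hw.2, hwy⟩
      rcases cover w hwW with ⟨c, hc, hxc, hcw⟩ | ⟨c, hc, hyc, hcw⟩
      · have hac : ReachIn G S₂ a c := by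
          by_cases hac : a = c
          · rw [hac]; exact .refl _
          · exact .of_adj (clique x hrx a haW c hc hxa hxc hac) (hWS₂ haW) (hWS₂ hc)
        exact (((hyB b hbW hyb).trans ((hbv.trans hav.symm).mono hWS₂)).trans hac).trans
          (hcw.mono hWS₂)
      · exact (hyB c hc hyc).trans (hcw.mono hWS₂)
    obtain ⟨d, hd⟩ := cliqueRich y hry S₂ Set.sdiff_subset
      (fun v hv hyv => ⟨hv.1.1, hv.1.2, hv.2, hyv.ne'⟩) hconn hyS₂
      ⟨b₀, hWS₂ hb₀, hyb₀.ne'⟩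
    -- Every edge at x except rx gets colour `κ`, while the edge from y to `b₀` does not, so x and y
    -- cannot be swapped.
    obtain ⟨κ, hκ⟩ := exists_ne (d 0 s(y, b₀))
    refine ⟨glue x (fun _ => κ) (d 0), fun φ h1 h2 h3 => ?_⟩
    have h4 := h3.of_glue h2
    have hxT : x ∈ S \ {r} := ⟨hx, hrx.ne'⟩
    rcases swap φ h1 h2 with ⟨hφx, hφy⟩ | ⟨hφx, hφy⟩
    · have h5 := (hd 0 (by norm_num) 0 (by norm_num) φ ((h1.diff_root h2).diff_root hφx) hφy
        (h4.of_glue hφx)).2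
      intro v hv
      by_cases hvr : v = r
      · rw [hvr, h2]
      by_cases hvx : v = x
      · rw [hvx, hφx]
      exact h5 v ⟨⟨hv, hvr⟩, hvx⟩
    · have := h4 y ⟨hy, hry.ne'⟩ b₀ ⟨hb₀.1, hb₀.2.1⟩ hyb₀
      rw [hφy, glue_root, glue_of_ne _ _ hxy.ne' hb₀x] at this
      exact absurd this hκ
  · set Y := reachSet G W x with hY
    set Z := reachSet G W y with hZ
    have hYZ : ∀ v ∈ Y, v ∉ Z := fun v h h' => hcase ⟨v, h, h'⟩
    have hYW : Y ⊆ W := reachSet_subset W x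
    have hZW : Z ⊆ W := reachSet_subset W y
    have ha₀Y : a₀ ∈ Y := mem_reachSet_of_adj ha₀ hxa₀
    have hb₀Z : b₀ ∈ Z := mem_reachSet_of_adj hb₀ hyb₀
    have hyY : y ∉ insert x Y := by
      rintro (h | h)
      · exact hxy.ne h.symm
      · exact (hYW h).2.2.2 rfl
    have hxZ : x ∉ insert y Z := by
      rintro (h | h)
      · exact hxy.ne h
      · exact (hZW h).2.2.1 rfl
    obtain ⟨c, hc⟩ := cliqueRich x hrx (insert x Y)
      (Set.insert_subset ⟨hx, hrx.ne'⟩ fun v hv => ⟨(hYW hv).1, (hYW hv).2.1⟩)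
      (fun v hv hxv => hv.elim (fun h => absurd h hxv.ne') fun h => hYW h)
      (connOn_insert_reachSet W x) (Set.mem_insert _ _)
      ⟨a₀, Set.mem_insert_of_mem _ ha₀Y, hxa₀.ne'⟩
    obtain ⟨d, hd⟩ := cliqueRich y hry (insert y Z)
      (Set.insert_subset ⟨hy, hry.ne'⟩ fun v hv => ⟨(hZW hv).1, (hZW hv).2.1⟩)
      (fun v hv hxv => hv.elim (fun h => absurd h hxv.ne') fun h => hZW h)
      (connOn_insert_reachSet W y) (Set.mem_insert _ _)
      ⟨b₀, Set.mem_insert_of_mem _ hb₀Z, hyb₀.ne'⟩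
    -- Two candidates: `c 0` or `c 1` on the side of x, always `d 0` on the side of y.
    let e : ℕ → Sym2 V → Fin 2 := fun i z => if ∃ v ∈ z, v ∈ Y then c i z else d 0 z
    have heY : ∀ i, ∀ u ∈ insert x Y, ∀ v ∈ insert x Y, G.Adj u v → e i s(u, v) = c i s(u, v) := by
      intro i u hu v hv huv
      refine if_pos ?_
      rcases hu with rfl | hu
      · rcases hv with rfl | hv
        · exact absurd rfl huv.ne
        · exact ⟨v, by simp, hv⟩
      · exact ⟨u, by simp, hu⟩
    have heZ : ∀ i, ∀ u ∈ insert y Z, ∀ v ∈ insert y Z, e i s(u, v) = d 0 s(u, v) := by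
      intro i u hu v hv
      refine if_neg ?_
      have : ∀ w ∈ insert y Z, w ∉ Y := by
        rintro w (rfl | hw) h
        · exact hyY (Set.mem_insert_of_mem _ h)
        · exact hYZ w h hw
      rintro ⟨w, hw, hwY⟩
      rcases Sym2.mem_iff.1 hw with rfl | rfl
      · exact this _ hu hwY
      · exact this _ hv hwY
    have hYr : insert x Y ⊆ S \ {r} :=
      Set.insert_subset ⟨hx, hrx.ne'⟩ fun v hv => ⟨(hYW hv).1, (hYW hv).2.1⟩
    have hZr : insert y Z ⊆ S \ {r} :=
      Set.insert_subset ⟨hy, hry.ne'⟩ fun v hv => ⟨(hZW hv).1, (hZW hv).2.1⟩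
    have fixed : ∀ i < 2, ∀ φ, IsoOn G S S φ → φ r = r →
        CarriesOn G S (glue r (fun _ => 0) (e i)) (glue r (fun _ => 0) (e i)) φ →
        φ x = x → φ y = y → ∀ v ∈ S, φ v = v := by
      intro i hi φ h1 h2 h3 h4 h5
      have h6 := h3.of_glue h2
      have mY : ∀ v, φ v ∈ insert x Y ↔ v ∈ insert x Y := fun v => by
        have := map_mem_reachSet h1 (isoW φ h1 h2) hWS hx (v := v)
        rw [h4] at this
        simp only [Set.mem_insert_iff, apply_eq_iff h4, hY, this]
      have mZ : ∀ v, φ v ∈ insert y Z ↔ v ∈ insert y Z := fun v => by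
        have := map_mem_reachSet h1 (isoW φ h1 h2) hWS hy (v := v)
        rw [h5] at this
        simp only [Set.mem_insert_iff, apply_eq_iff h5, hZ, this]
      have fY := (hc i hi i hi φ ((h1.diff_root h2).restrict hYr mY) h4 (by
        intro u hu v hv huv
        have := h6 u (hYr hu) v (hYr hv) huv
        rwa [heY i u hu v hv huv, heY i _ ((mY u).2 hu) _ ((mY v).2 hv)
          ((h1.2 u (hYr hu).1 v (hYr hv).1).2 huv)] at this)).2
      have fZ := (hd 0 (by norm_num) 0 (by norm_num) φ ((h1.diff_root h2).restrict hZr mZ) h5 (by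
        intro u hu v hv huv
        have := h6 u (hZr hu) v (hZr hv) huv
        rwa [heZ i u hu v hv, heZ i _ ((mZ u).2 hu) _ ((mZ v).2 hv)] at this)).2
      intro v hv
      by_cases hvr : v = r
      · rw [hvr, h2]
      by_cases hvx : v = x
      · rw [hvx, h4]
      by_cases hvy : v = y
      · rw [hvy, h5]
      rcases cover v ⟨hv, hvr, hvx, hvy⟩ with h | h
      · exact fY v (Or.inr h)
      · exact fZ v (Or.inr h)
    have swapped : ∀ i < 2, ∀ φ, IsoOn G S S φ → φ r = r →
        CarriesOn G S (glue r (fun _ => 0) (e i)) (glue r (fun _ => 0) (e i)) φ →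
        φ x = y → φ y = x → IsoOn G (insert x Y) (insert y Z) φ ∧
          CarriesOn G (insert x Y) (c i) (d 0) φ := by
      intro i hi φ h1 h2 h3 h4 h5
      have h6 := h3.of_glue h2
      have mY : ∀ v, φ v ∈ insert y Z ↔ v ∈ insert x Y := fun v => by
        have := map_mem_reachSet h1 (isoW φ h1 h2) hWS hx (v := v)
        rw [h4] at this
        have h7 : φ v = y ↔ v = x := by rw [← h4, φ.injective.eq_iff]
        simp only [Set.mem_insert_iff, h7, hY, hZ, this]
      refine ⟨(h1.diff_root h2).restrict hYr mY |>.restrict subset_rfl mY, ?_⟩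
      intro u hu v hv huv
      have := h6 u (hYr hu) v (hYr hv) huv
      rwa [heY i u hu v hv huv, heZ i _ ((mY u).2 hu) _ ((mY v).2 hv)] at this
    by_contra hcon
    push Not at hcon
    have get : ∀ i < 2, ∃ φ : Equiv.Perm V, φ x = y ∧ IsoOn G (insert x Y) (insert y Z) φ ∧
          CarriesOn G (insert x Y) (c i) (d 0) φ := by
      intro i hi
      obtain ⟨φ, h1, h2, h3, v, hv, hvne⟩ := hcon (e i)
      rcases swap φ h1 h2 with ⟨h4, h5⟩ | ⟨h4, h5⟩
      · exact absurd (fixed i hi φ h1 h2 h3 h4 h5 v hv) hvne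
      · exact ⟨φ, h4, swapped i hi φ h1 h2 h3 h4 h5⟩
    obtain ⟨φ, h1, h2, h3⟩ := get 0 (by norm_num)
    obtain ⟨ψ, k1, k2, k3⟩ := get 1 (by norm_num)
    have := (hc 0 (by norm_num) 1 (by norm_num) (ψ⁻¹ * φ) (h2.trans k2.symm)
      (by rw [Equiv.Perm.mul_apply, h1, Equiv.Perm.inv_eq_iff_eq, k1])
      (h3.trans h2 (k3.symm k2))).1
    omega

end ConnectedCase

end SimpleGraph

namespace SimpleGraph

/-! ### The root is not a cut vertex. -/

section ConnectedCase

variable {V : Type*} {G : SimpleGraph V}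

/-- The centre is adjacent to all other vertices, whereas every other vertex has a non-neighbour
because k ≥ 2. -/
lemma Exceptional.unique [Finite V] {k : ℕ} (hk : 2 ≤ k) {S : Set V} {x y : V}
    (hy : y ∈ S) (hEx : Exceptional G k S x) (hEy : Exceptional G k S y) : x = y := by
  by_contra hxy
  obtain ⟨z, hz, hzy, hn⟩ := hEx.exists_not_adj hk hy (Ne.symm hxy)
  exact hn (hEy.adj hz hzy)

/-- If the rooted graph without its root is rich when rooted at a neighbour `x` of `r`, then so is
the rooted graph itself; the colouring family is explicit. -/
lemma rigid_glue {k : ℕ} {S : Set V} {r x : V} (hr : r ∈ S) (hx : x ∈ S)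
    (hrx : G.Adj r x) {d : ℕ → Sym2 V → Fin k} {M : ℕ} (hd : Rigid G (S \ {r}) x d M)
    {α β : Fin k} (hαβ : α ≠ β) :
    Rigid G S r (fun a => glue r (open Classical in fun v => if v = x then α else β) (d a)) M := by
  classical
  refine hd.extend hr (fun _ v => if v = x then α else β) (fun a => a) (fun a h => h) ?_
  intro a _ b _ φ _ _ h3
  refine ⟨?_, id⟩
  have := h3 x hx hrx
  by_contra hne
  simp only [hne, if_true, if_false] at this
  exact hαβ this.symm

/-- The only neighbour is fixed automatically, so the colour of rx is free. One colour serves the k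
given colourings; a second colour, combined with `d 0`, gives one more. -/
lemma rich_of_unique_neighbor {k : ℕ} (hk : 2 ≤ k) {S : Set V} {r x : V} (hr : r ∈ S) (hx : x ∈ S)
    (hrx : G.Adj r x) (hN : ∀ v ∈ S, G.Adj r v → v = x) (hT : Rich G (Fin k) (S \ {r}) x k) :
    Rich G (Fin k) S r (k + 1) := by
  obtain ⟨d, hd⟩ := hT
  let z0 : Fin k := ⟨0, by omega⟩
  let z1 : Fin k := ⟨1, by omega⟩
  have hz : z0 ≠ z1 := by simp [z0, z1]
  refine ⟨_, hd.extend hr (M := k + 1) (fun a _ => if a < k then z0 else z1)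
    (fun a => if a < k then a else 0) ?_ ?_⟩
  · intro a _
    split_ifs <;> omega
  · intro a ha b hb φ h1 h2 h3
    have hφx : φ x = x := hN _ ((h1.1 x).2 hx) (by
      have := (h1.2 r hr x hx).2 hrx
      rwa [h2] at this)
    refine ⟨hφx, fun h => ?_⟩
    have := h3 x hx hrx
    by_cases hak : a < k <;> by_cases hbk : b < k <;> simp only [hak, hbk, if_true, if_false] at this h
    · exact h
    · exact absurd this.symm hz
    · exact absurd this hz
    · omega

/-- The additional colouring exchanges the two colours at r. It has at least two edges of the colour
that occurs there exactly once in the lifted family. -/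
lemma rich_of_three_neighbors {k : ℕ} (hk : 2 ≤ k) {S : Set V} {r x u w : V} (hr : r ∈ S)
    (hx : x ∈ S) (hu : u ∈ S) (hw : w ∈ S) (hrx : G.Adj r x) (hru : G.Adj r u) (hrw : G.Adj r w)
    (hux : u ≠ x) (hwx : w ≠ x) (huw : u ≠ w) (hT : Rich G (Fin k) (S \ {r}) x k) :
    Rich G (Fin k) S r (k + 1) := by
  classical
  obtain ⟨d, hd⟩ := hT
  let z0 : Fin k := ⟨0, by omega⟩
  let z1 : Fin k := ⟨1, by omega⟩
  have hz : z0 ≠ z1 := by simp [z0, z1]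
  refine (rigid_glue hr hx hrx hd hz).append
    (glue r (fun v => if v = x then z1 else z0) (d 0)) ?_ ?_
  · intro φ h1 h2 h3
    have := (rigid_glue hr hx hrx hd hz.symm) 0 (by omega) 0 (by omega) φ h1 h2
    exact (this (by convert h3)).2
  · intro i hi φ h1 h2 h3
    have e1 := h3.root_of_glue hr h2 hu hru
    have e2 := h3.root_of_glue hr h2 hw hrw
    simp only [hux, hwx, if_false] at e1 e2
    have f1 : φ u = x := by by_contra h; simp [h] at e1; exact hz e1.symm
    have f2 : φ w = x := by by_contra h; simp [h] at e2; exact hz e2.symm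
    exact huw (φ.injective (f1.trans f2.symm))

/-- The additional colouring uses at r a third colour, absent there from the lifted family. -/
lemma rich_of_two_neighbors_of_three_colors {k : ℕ} (hk : 3 ≤ k) {S : Set V} {r x y : V}
    (hr : r ∈ S) (hx : x ∈ S) (hy : y ∈ S) (hxy : x ≠ y)
    (hN : ∀ v ∈ S, G.Adj r v ↔ v = x ∨ v = y) (hT : Rich G (Fin k) (S \ {r}) x k) :
    Rich G (Fin k) S r (k + 1) := by
  classical
  obtain ⟨d, hd⟩ := hT
  have hrx : G.Adj r x := (hN x hx).2 (Or.inl rfl)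
  have hry : G.Adj r y := (hN y hy).2 (Or.inr rfl)
  let z0 : Fin k := ⟨0, by omega⟩
  let z1 : Fin k := ⟨1, by omega⟩
  let z2 : Fin k := ⟨2, by omega⟩
  have h01 : z0 ≠ z1 := by simp [z0, z1]
  have h02 : z0 ≠ z2 := by simp [z0, z2]
  have h12 : z1 ≠ z2 := by simp [z1, z2]
  refine (rigid_glue hr hx hrx hd h01).append
    (glue r (fun v => if v = x then z0 else z2) (d 0)) ?_ ?_
  · intro φ h1 h2 h3
    have := (rigid_glue hr hx hrx hd h02) 0 (by omega) 0 (by omega) φ h1 h2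
    exact (this (by convert h3)).2
  · intro i hi φ h1 h2 h3
    have e2 := h3.root_of_glue hr h2 hy hry
    simp only [hxy.symm, if_false] at e2
    by_cases h : φ y = x
    · simp only [h, if_true] at e2; exact h02 e2
    · simp only [h, if_false] at e2; exact h12 e2

/-- The lifted family puts 0 on rx and 1 on ry. If no rooted automorphism swaps x and y, exchanging
these colours gives a new colouring. Otherwise the new one gives both edges colour 0. -/
lemma rich_of_two_neighbors_of_two_colors [Finite V] (hL : LocallyIndepLE G 2) {S : Set V}
    {r x y : V} (hr : r ∈ S) (hx : x ∈ S) (hy : y ∈ S) (hxy : G.Adj x y)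
    (hN : ∀ v ∈ S, G.Adj r v ↔ v = x ∨ v = y) (hT : ConnOn G (S \ {r}))
    (hTx : Rich G (Fin 2) (S \ {r}) x 2) (hS : S \ {r} ≠ {x, y})
    (IH : ∀ (S' : Set V) (r' : V), S'.ncard < S.ncard → r' ∈ S' → ConnOn G S' →
      Rich G (Fin 2) S' r' 2 ∨ S' = {r'} ∨ Exceptional G 2 S' r') :
    Rich G (Fin 2) S r 3 := by
  classical
  obtain ⟨d, hd⟩ := hTx
  have hrx : G.Adj r x := (hN x hx).2 (Or.inl rfl)
  have hry : G.Adj r y := (hN y hy).2 (Or.inr rfl)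
  have h01 : (0 : Fin 2) ≠ 1 := by decide
  have hR := rigid_glue hr hx hrx hd h01
  have sw : ∀ φ : Equiv.Perm V, IsoOn G S S φ → φ r = r → φ x ≠ x → φ x = y := by
    intro φ h1 h2 h
    have := (h1.2 r hr x hx).2 hrx
    rw [h2, hN _ ((h1.1 x).2 hx)] at this
    exact this.resolve_left h
  by_cases hswap : ∃ σ, IsoOn G S S σ ∧ σ r = r ∧ σ x = y
  · obtain ⟨σ, s1, s2, s3⟩ := hswap
    have s4 : σ y = x := by
      have := (s1.2 r hr y hy).2 hry
      rw [s2, hN _ ((s1.1 y).2 hy)] at this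
      refine this.resolve_right fun h => hxy.ne (σ.injective (s3.trans h.symm))
    -- The swap `σ` turns a further neighbour of one of x, y into one of the other, so a single such
    -- neighbour, provided by connectedness, is enough.
    have move : ∀ p q, p ∈ S → σ p = q → σ q = p → (∃ a ∈ S, G.Adj p a ∧ a ≠ r ∧ a ≠ q) →
        ∃ a ∈ S, G.Adj q a ∧ a ≠ r ∧ a ≠ p := by
      rintro p q hp h1 h2 ⟨a, ha, h3, h4, h5⟩
      refine ⟨σ a, (s1.1 a).2 ha, ?_, apply_ne s2 h4, ?_⟩
      · rw [← h1]; exact (s1.2 p hp a ha).2 h3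
      · rw [← h2]; exact fun h => h5 (σ.injective h)
    have hex : (∃ a ∈ S, G.Adj x a ∧ a ≠ r ∧ a ≠ y) ∨ ∃ b ∈ S, G.Adj y b ∧ b ≠ r ∧ b ≠ x := by
      by_contra hcon
      push Not at hcon
      refine hS (Set.Subset.antisymm (fun v hv => ?_) ?_)
      · refine hT.mem_of_closed (a := x) ⟨hx, hrx.ne'⟩ (by simp) ?_ hv
        rintro a (rfl | rfl) b ⟨hb, hbr⟩ hab
        · exact Or.inr (hcon.1 b hb hab hbr)
        · exact Or.inl (hcon.2 b hb hab hbr)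
      · rintro v (rfl | rfl)
        · exact ⟨hx, hrx.ne'⟩
        · exact ⟨hy, hry.ne'⟩
    obtain ⟨hA, hB⟩ : (∃ a ∈ S, G.Adj x a ∧ a ≠ r ∧ a ≠ y) ∧ ∃ b ∈ S, G.Adj y b ∧ b ≠ r ∧ b ≠ x :=
      hex.elim (fun h => ⟨h, move x y hx s3 s4 h⟩) fun h => ⟨move y x hy s4 s3 h, h⟩
    obtain ⟨e, he⟩ := exists_distinguishing_of_two_neighbors hL hr hx hy hxy hN hT hA hB IH
    refine hR.append _ he ?_
    intro i hi φ h1 h2 h3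
    have key : ∀ p ∈ S, G.Adj r p → φ p = x := by
      intro p hp hrp
      have := h3.root_of_glue hr h2 hp hrp
      by_contra h
      simp [h] at this
    exact hxy.ne (φ.injective ((key x hx hrx).trans (key y hy hry).symm))
  · refine hR.append (glue r (fun v => if v = x then 1 else 0) (d 0)) ?_ ?_
    · intro φ h1 h2 h3
      have := (rigid_glue hr hx hrx hd h01.symm) 0 (by omega) 0 (by omega) φ h1 h2
      exact (this (by convert h3)).2
    · intro i hi φ h1 h2 h3
      have := h3.root_of_glue hr h2 hx hrx
      refine hswap ⟨φ, h1, h2, sw φ h1 h2 fun h => ?_⟩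
      simp [h] at this

lemma ConnOn.exists_adj {S : Set V} (hS : ConnOn G S) {r u : V} (hr : r ∈ S) (hu : u ∈ S)
    (hur : u ≠ r) : ∃ v ∈ S, G.Adj r v := by
  by_contra hcon
  push Not at hcon
  exact hur (hS.mem_of_closed (A := {r}) hr rfl
    (by rintro a rfl b hb hab; exact absurd hab (hcon b hb)) hu)

lemma rich_of_pair {k : ℕ} (hk : 0 < k) {S : Set V} {r a : V} (hr : r ∈ S)
    (hSa : S \ {r} = {a}) (hra : G.Adj r a) : Rich G (Fin k) S r k := by
  have ha : a ∈ S := (hSa ▸ rfl : a ∈ S \ {r}).1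
  have hd : Rigid G (S \ {r}) a (fun _ _ => (⟨0, hk⟩ : Fin k)) 1 := by
    intro i hi j hj φ _ h _
    refine ⟨by omega, fun v hv => ?_⟩
    rw [hSa] at hv
    rw [Set.mem_singleton_iff.1 hv, h]
  -- The only edge gets colour i; the reduction mod k merely makes this defined for every natural
  -- number.
  refine ⟨_, hd.extend hr (fun i _ => ⟨i % k, Nat.mod_lt _ hk⟩) (fun _ => 0) (fun _ _ => one_pos) ?_⟩
  intro i hi j hj φ h1 h2 h3
  refine ⟨?_, fun _ => ?_⟩
  · have : a ∈ S \ {r} := by rw [hSa]; rfl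
    have := ((h1.diff_root h2).1 a).2 this
    rwa [hSa] at this
  · have := h3 a ha hra
    simp only [Fin.mk.injEq, Nat.mod_eq_of_lt hi, Nat.mod_eq_of_lt hj] at this
    exact this.symm

/-- The inductive step for a root that is not a cut vertex. -/
lemma rich_of_connOn_diff [Finite V] {k : ℕ} (hk : 2 ≤ k) (hL : LocallyIndepLE G k) {S : Set V}
    {r : V} (hr : r ∈ S) (hS : ConnOn G S) (hT : ConnOn G (S \ {r}))
    (IH : ∀ (S' : Set V) (r' : V), S'.ncard < S.ncard → r' ∈ S' → ConnOn G S' →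
      Rich G (Fin k) S' r' k ∨ S' = {r'} ∨ Exceptional G k S' r') :
    Rich G (Fin k) S r k ∧
      ((∀ u ∈ S, ∀ v ∈ S, G.Adj r u → G.Adj r v → u ≠ v → G.Adj u v) →
        Rich G (Fin k) S r (k + 1) ∨ (∃ a, S \ {r} = {a} ∧ G.Adj r a) ∨
          (k = 2 ∧ ∃ a b, a ≠ b ∧ S \ {r} = {a, b} ∧ G.Adj r a ∧ G.Adj r b ∧ G.Adj a b)) := by
  have hlt : (S \ {r}).ncard < S.ncard := Set.ncard_sdiff_singleton_lt_of_mem hr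
  obtain ⟨u, hu⟩ := hT.1
  obtain ⟨x, hx, hrx⟩ := hS.exists_adj hr hu.1 hu.2
  have hxT : x ∈ S \ {r} := ⟨hx, hrx.ne'⟩
  by_cases h1 : ∀ v ∈ S, G.Adj r v → v = x
  · rcases IH _ x hlt hxT hT with h | h | h
    · have := rich_of_unique_neighbor hk hr hx hrx h1 h
      exact ⟨this.mono (by omega), fun _ => Or.inl this⟩
    · exact ⟨rich_of_pair (by omega) hr h hrx, fun _ => Or.inr (Or.inl ⟨x, h, hrx⟩)⟩
    · classical
      exfalso
      -- Adding r to `I` gives k + 1 independent neighbours of x.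
      obtain ⟨I, hI, hI1, hI2⟩ := h.exists_indep
      have hrI : r ∉ I := fun h => (hI1 r h).1.2 rfl
      have hnr : ∀ v ∈ I, ¬ G.Adj r v := fun v hv h =>
        (hI1 v hv).2.ne (h1 v (hI1 v hv).1.1 h).symm
      have := hL x (insert r I) (by
        intro v hv
        rcases Finset.mem_insert.1 hv with rfl | hv
        · exact hrx.symm
        · exact (hI1 v hv).2) (by
        intro v hv w hw
        rcases Finset.mem_insert.1 hv with rfl | hv' <;> rcases Finset.mem_insert.1 hw with rfl | hw'
        · exact G.irrefl
        · exact hnr w hw'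
        · exact fun h => hnr v hv' h.symm
        · exact hI2 v hv' w hw')
      rw [Finset.card_insert_of_notMem hrI] at this
      omega
  · push Not at h1
    obtain ⟨y, hy, hry, hyx⟩ := h1
    obtain ⟨x, y, hx, hy, hrx, hry, hyx, hxR⟩ : ∃ x y, x ∈ S ∧ y ∈ S ∧ G.Adj r x ∧ G.Adj r y ∧
        y ≠ x ∧ Rich G (Fin k) (S \ {r}) x k := by
      have hyT : y ∈ S \ {r} := ⟨hy, hry.ne'⟩
      rcases IH _ x hlt hxT hT with h | h | h
      · exact ⟨x, y, hx, hy, hrx, hry, hyx, h⟩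
      · rw [h] at hyT; exact absurd hyT hyx
      -- Exceptional at x, the remainder cannot be exceptional at y too, so y takes the role of x.
      rcases IH _ y hlt hyT hT with h' | h' | h'
      · exact ⟨y, x, hy, hx, hry, hrx, hyx.symm, h'⟩
      · rw [h'] at hxT; exact absurd hxT hyx.symm
      · exact absurd (h'.unique hk hxT h) hyx
    have base : Rich G (Fin k) S r k := by
      obtain ⟨d, hd⟩ := hxR
      have h01 : (⟨0, by omega⟩ : Fin k) ≠ ⟨1, by omega⟩ := by simp
      exact ⟨_, rigid_glue hr hx hrx hd h01⟩
    refine ⟨base, fun hcl => ?_⟩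
    by_cases h2 : ∃ w ∈ S, G.Adj r w ∧ w ≠ x ∧ w ≠ y
    · obtain ⟨w, hw, hrw, hwx, hwy⟩ := h2
      exact Or.inl (rich_of_three_neighbors hk hr hx hy hw hrx hry hrw hyx hwx hwy.symm hxR)
    · push Not at h2
      have hN : ∀ v ∈ S, G.Adj r v ↔ v = x ∨ v = y := fun v hv =>
        ⟨fun h => or_iff_not_imp_left.2 (h2 v hv h), by rintro (rfl | rfl) <;> assumption⟩
      have hxy := hcl x hx y hy hrx hry hyx.symm
      rcases hk.lt_or_eq with hk3 | rfl
      · exact Or.inl (rich_of_two_neighbors_of_three_colors hk3 hr hx hy hyx.symm hN hxR)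
      · by_cases hST : S \ {r} = {x, y}
        · exact Or.inr (Or.inr ⟨rfl, x, y, hyx.symm, hST, hrx, hry, hxy⟩)
        · exact Or.inl (rich_of_two_neighbors_of_two_colors hL hr hx hy hxy hN hT hxR hST IH)

end ConnectedCase

end SimpleGraph

namespace SimpleGraph

/-! ### Combining colourings of the branches at the root. -/

section Components

variable {V : Type*} {G : SimpleGraph V} {K : Type*}

/-- The vertex sets of the connected components of `G[T]`. -/
def componentsOn (G : SimpleGraph V) (T : Set V) : Set (Set V) :=
  {C | ∃ x ∈ T, C = {v | ReachIn G T x v}}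

variable {T C D : Set V}

lemma subset_of_mem_componentsOn (hC : C ∈ componentsOn G T) : C ⊆ T := by
  obtain ⟨x, hx, rfl⟩ := hC
  exact fun v hv => ReachIn.mem hv hx

lemma componentsOn_closed (hC : C ∈ componentsOn G T) :
    ∀ a ∈ C, ∀ b ∈ T, G.Adj a b → b ∈ C := by
  obtain ⟨x, hx, rfl⟩ := hC
  exact fun a ha b hb hab => ReachIn.trans ha (.of_adj hab (ReachIn.mem ha hx) hb)

lemma connOn_of_mem_componentsOn (hC : C ∈ componentsOn G T) : ConnOn G C := by
  have hcl := componentsOn_closed hC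
  obtain ⟨x, hx, rfl⟩ := hC
  exact connOn_of_root (ReachIn.refl x) fun v hv => ReachIn.restrict hcl hv (ReachIn.refl x)

lemma componentsOn_eq (hC : C ∈ componentsOn G T) {v : V} (hv : v ∈ C) :
    C = {w | ReachIn G T v w} := by
  obtain ⟨x, hx, rfl⟩ := hC
  ext w
  exact ⟨fun h => (ReachIn.symm hv).trans h, fun h => ReachIn.trans hv h⟩

lemma componentsOn_eq_of_mem (hC : C ∈ componentsOn G T) (hD : D ∈ componentsOn G T) {v : V}
    (hvC : v ∈ C) (hvD : v ∈ D) : C = D := by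
  rw [componentsOn_eq hC hvC, componentsOn_eq hD hvD]

lemma exists_mem_componentsOn {v : V} (hv : v ∈ T) : ∃ C ∈ componentsOn G T, v ∈ C :=
  ⟨_, ⟨v, hv, rfl⟩, ReachIn.refl v⟩

lemma image_mem_componentsOn {φ : Equiv.Perm V} (hφ : IsoOn G T T φ)
    (hC : C ∈ componentsOn G T) : φ '' C ∈ componentsOn G T := by
  obtain ⟨x, hx, rfl⟩ := hC
  refine ⟨φ x, (hφ.1 x).2 hx, ?_⟩
  ext v
  constructor
  · rintro ⟨w, hw, rfl⟩
    exact ReachIn.map hφ hw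
  · intro h
    refine ⟨φ⁻¹ v, ?_, by simp⟩
    have := ReachIn.map hφ.symm h
    simpa using this

/-- Colourings of the components of `G[S \ {r}]` together with `r` combine to colourings of
`(G[S], r)`. -/
lemma rich_of_components [Nonempty K] {S : Set V} {r : V} (hr : r ∈ S) {N M : ℕ}
    (hN : ∀ C ∈ componentsOn G (S \ {r}), Rich G K (insert r C) r N)
    (Q : Set (Set V)) (hQ : Q ⊆ componentsOn G (S \ {r}))
    (hQφ : ∀ φ, IsoOn G S S φ → φ r = r → ∀ C ∈ Q, φ '' C ∈ Q)
    (f : ℕ → Set V → ℕ) (hf : ∀ a < M, ∀ C ∈ componentsOn G (S \ {r}), f a C < N)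
    (hfQ : ∀ a < M, Set.InjOn (f a) Q)
    (hfQc : ∀ a < M, Set.InjOn (f a) (componentsOn G (S \ {r}) \ Q))
    (hff : ∀ a < M, ∀ b < M, f a '' Q = f b '' Q → a = b) : Rich G K S r M := by
  classical
  -- Each branch copies the family of a representative of its rooted isomorphism class, so that
  -- indices on isomorphic branches can be compared.
  let E : Setoid (componentsOn G (S \ {r})) :=
    { r := fun C D => ∃ σ : Equiv.Perm V, σ r = r ∧ IsoOn G (insert r C.1) (insert r D.1) σ
      iseqv := ⟨fun C => ⟨1, rfl, .refl _⟩,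
        fun ⟨σ, h1, h2⟩ => ⟨σ⁻¹, by rw [Equiv.Perm.inv_eq_iff_eq, h1], h2.symm⟩,
        fun ⟨σ, h1, h2⟩ ⟨τ, k1, k2⟩ => ⟨τ * σ, by rw [Equiv.Perm.mul_apply, h1, k1],
          h2.trans k2⟩⟩ }
  let rep : componentsOn G (S \ {r}) → componentsOn G (S \ {r}) := fun C =>
    Quotient.out (Quotient.mk E C)
  have hrep : ∀ C, ∃ σ : Equiv.Perm V, σ r = r ∧ IsoOn G (insert r (rep C).1) (insert r C.1) σ :=
    fun C => Quotient.mk_out (s := E) C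
  choose σ hσr hσ using hrep
  choose d hd using fun C : componentsOn G (S \ {r}) => hN C.1 C.2
  let e : ℕ → Sym2 V → K := fun a z =>
    if h : ∃ C : componentsOn G (S \ {r}), ∀ v ∈ z, v ∈ insert r C.1 then
      d (rep h.choose) (f a h.choose.1) (z.map ⇑((σ h.choose)⁻¹ : Equiv.Perm V))
    else Classical.arbitrary K
  have he : ∀ a (C : componentsOn G (S \ {r})), ∀ u ∈ insert r C.1, ∀ v ∈ insert r C.1,
      G.Adj u v → e a s(u, v) = d (rep C) (f a C.1) s((σ C)⁻¹ u, (σ C)⁻¹ v) := by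
    intro a C u hu v hv huv
    have h : ∃ C : componentsOn G (S \ {r}), ∀ w ∈ s(u, v), w ∈ insert r C.1 :=
      ⟨C, fun w hw => by rcases Sym2.mem_iff.1 hw with rfl | rfl <;> assumption⟩
    -- An edge has an endpoint other than r, and this lies in only one component; the default value
    -- of `e` therefore never falls on an edge of a branch.
    have hC : h.choose = C := by
      have hs := h.choose_spec
      have key : ∀ w ∈ s(u, v), w ∈ insert r C.1 → w ≠ r → h.choose = C := fun w hw hwC hwr =>
        Subtype.ext (componentsOn_eq_of_mem h.choose.2 C.2 ((hs w hw).resolve_left hwr)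
          (hwC.resolve_left hwr))
      by_cases hur : u = r
      · exact key v (by simp) hv (fun h => huv.ne (hur.trans h.symm))
      · exact key u (by simp) hu hur
    simp only [e, dif_pos h, hC, Sym2.map_mk]
  refine ⟨e, fun a ha b hb φ h1 h2 h3 => ?_⟩
  have hT := h1.diff_root h2
  have hsub : ∀ C ∈ componentsOn G (S \ {r}), insert r C ⊆ S := fun C hC =>
    Set.insert_subset hr fun v hv => (subset_of_mem_componentsOn hC hv).1
  have himg : ∀ C : Set V, ∀ v, φ v ∈ insert r (φ '' C) ↔ v ∈ insert r C := by
    intro C v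
    simp only [Set.mem_insert_iff, apply_eq_iff h2, φ.injective.mem_set_image]
  -- Between branches, an isomorphism of colourings preserves the index and is the canonical one.
  have main : ∀ C D : componentsOn G (S \ {r}), φ '' C.1 = D.1 → f a C.1 = f b D.1 ∧
      ∀ v ∈ insert r (rep C).1, φ (σ C v) = σ D v := by
    intro C D hCD
    have hiso : IsoOn G (insert r C.1) (insert r D.1) φ := by
      rw [← hCD]
      refine ⟨himg _, fun u hu v hv => h1.2 u (hsub _ C.2 hu) v (hsub _ C.2 hv)⟩
    have hrr : rep C = rep D := by
      have : Quotient.mk E C = Quotient.mk E D := Quotient.sound ⟨φ, h2, hiso⟩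
      simp only [rep, this]
    have hD := hσ D
    rw [← hrr] at hD
    have := hd (rep C) (f a C.1) (hf a ha _ C.2) (f b D.1) (hf b hb _ D.2)
      ((σ D)⁻¹ * (φ * σ C)) (((hσ C).trans hiso).trans hD.symm)
      (by rw [Equiv.Perm.mul_apply, Equiv.Perm.mul_apply, hσr, h2, Equiv.Perm.inv_eq_iff_eq, hσr])
      (by
        intro u hu v hv huv
        have hu' := ((hσ C).1 u).2 hu
        have hv' := ((hσ C).1 v).2 hv
        have huv' := ((hσ C).2 u hu v hv).2 huv
        have := h3 _ (hsub _ C.2 hu') _ (hsub _ C.2 hv') huv'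
        rw [he a C _ hu' _ hv' huv', he b D _ ((hiso.1 _).2 hu') _ ((hiso.1 _).2 hv')
          ((hiso.2 _ hu' _ hv').2 huv'), ← hrr] at this
        simpa using this)
    refine ⟨this.1, fun v hv => ?_⟩
    have := this.2 v hv
    rwa [Equiv.Perm.mul_apply, Equiv.Perm.mul_apply, Equiv.Perm.inv_eq_iff_eq] at this
  have hinv : φ⁻¹ r = r := by rw [Equiv.Perm.inv_eq_iff_eq, h2]
  have back : ∀ C : Set V, φ '' ((φ⁻¹ : Equiv.Perm V) '' C) = C := fun C => by
    rw [Set.image_image]; simp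
  have back' : ∀ C : Set V, (φ⁻¹ : Equiv.Perm V) '' (φ '' C) = C := fun C => by
    rw [Set.image_image]; simp
  have fab : ∀ C ∈ componentsOn G (S \ {r}), f a C = f b (φ '' C) := fun C hC =>
    (main ⟨C, hC⟩ ⟨φ '' C, image_mem_componentsOn hT hC⟩ rfl).1
  have hab : a = b := by
    refine hff a ha b hb (Set.Subset.antisymm ?_ ?_)
    · rintro _ ⟨C, hC, rfl⟩
      exact ⟨φ '' C, hQφ φ h1 h2 C hC, (fab C (hQ hC)).symm⟩
    · rintro _ ⟨C, hC, rfl⟩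
      have hC' := hQφ φ⁻¹ h1.symm hinv C hC
      exact ⟨(φ⁻¹ : Equiv.Perm V) '' C, hC', by rw [fab _ (hQ hC'), back]⟩
  subst hab
  refine ⟨rfl, fun v hv => ?_⟩
  by_cases hvr : v = r
  · rw [hvr, h2]
  obtain ⟨C, hC, hvC⟩ := exists_mem_componentsOn (G := G) (show v ∈ S \ {r} from ⟨hv, hvr⟩)
  have hφC : φ '' C = C := by
    by_cases hCQ : C ∈ Q
    · exact hfQ a ha (hQφ φ h1 h2 C hCQ) hCQ (fab C hC).symm
    · refine hfQc a ha ⟨image_mem_componentsOn hT hC, fun h => hCQ ?_⟩ ⟨hC, hCQ⟩ (fab C hC).symm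
      rw [← back' C]
      exact hQφ _ h1.symm hinv _ h
  have hw := ((hσ ⟨C, hC⟩).symm.1 v).2 (Set.mem_insert_of_mem _ hvC)
  have := (main ⟨C, hC⟩ ⟨C, hC⟩ hφC).2 _ hw
  simpa using this

/-- By Pascal's rule, binom(N + 1, q + 1) is at least N from the first summand plus 1 from the
second. -/
lemma le_choose_of_pos_of_lt : ∀ {N q : ℕ}, 0 < q → q < N → N ≤ N.choose q
  | 0, _, _, h => absurd h (by omega)
  | N + 1, 0, h, _ => absurd h (by omega)
  | N + 1, q + 1, _, h => by
    rcases Nat.eq_zero_or_pos q with rfl | hq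
    · simp
    · rcases (by omega : N = q + 1 ∨ q + 1 < N) with rfl | h'
      · rw [Nat.choose_succ_self_right]
      · have h1 := le_choose_of_pos_of_lt hq (by omega : q < N)
        have h2 : 0 < N.choose (q + 1) := Nat.choose_pos (by omega)
        rw [Nat.choose_succ_succ']
        omega

/-- `N` functions from a finite set to `{0, …, N - 1}`, injective on a given subset and on its
complement, with distinct images of that subset. -/
lemma exists_injOn_family {α : Type*} {A Q : Set α} (hA : A.Finite) (hQA : Q ⊆ A)
    (hQ : Q.Nonempty) {N : ℕ} (hQN : Q.ncard < N) (hAN : A.ncard ≤ N) :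
    ∃ f : ℕ → α → ℕ, (∀ a < N, ∀ x ∈ A, f a x < N) ∧ (∀ a < N, Set.InjOn (f a) Q) ∧
      (∀ a < N, Set.InjOn (f a) (A \ Q)) ∧
      ∀ a < N, ∀ b < N, f a '' Q = f b '' Q → a = b := by
  classical
  have hQf := hA.subset hQA
  -- Choose N different index sets of size |Q|, one for each colouring.
  have hcard : Fintype.card (Fin N) ≤
      Fintype.card ((Finset.range N).powersetCard Q.ncard : Finset (Finset ℕ)) := by
    rw [Fintype.card_fin, Fintype.card_coe, Finset.card_powersetCard, Finset.card_range]
    exact le_choose_of_pos_of_lt ((Set.ncard_pos hQf).2 hQ) hQN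
  obtain ⟨B⟩ := Function.Embedding.nonempty_of_card_le hcard
  have hB : ∀ a, (B a).1 ⊆ Finset.range N ∧ (B a).1.card = Q.ncard := fun a =>
    Finset.mem_powersetCard.1 (B a).2
  have hbij : ∀ a, ∃ g : α → ℕ, Set.BijOn g Q (B a).1 := by
    intro a
    refine hQf.exists_bijOn_of_encard_eq ?_
    rw [Set.encard_coe_eq_coe_finsetCard, (hB a).2, hQf.cast_ncard_eq]
  choose g hg using hbij
  obtain ⟨h, hh1, hh2⟩ : ∃ h : α → ℕ, (A \ Q ⊆ h ⁻¹' (Finset.range N : Set ℕ)) ∧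
      Set.InjOn h (A \ Q) := by
    refine hA.sdiff.exists_injOn_of_encard_le ?_
    rw [Set.encard_coe_eq_coe_finsetCard, Finset.card_range, ← hA.sdiff.cast_ncard_eq]
    exact_mod_cast (Set.ncard_le_ncard Set.sdiff_subset hA).trans hAN
  have hQe : ∀ a (ha : a < N), Set.EqOn (fun x => if hx : a < N ∧ x ∈ Q then g ⟨a, hx.1⟩ x else h x)
      (g ⟨a, ha⟩) Q := fun a ha x hx => by simp [ha, hx]
  have hQce : ∀ a, Set.EqOn (fun x => if hx : a < N ∧ x ∈ Q then g ⟨a, hx.1⟩ x else h x)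
      h (A \ Q) := fun a x hx => by simp [hx.2]
  refine ⟨fun a x => if hx : a < N ∧ x ∈ Q then g ⟨a, hx.1⟩ x else h x, ?_, ?_, ?_, ?_⟩
  · intro a ha x hx
    by_cases hxQ : x ∈ Q
    · have := (hB ⟨a, ha⟩).1 ((hg ⟨a, ha⟩).mapsTo hxQ)
      simpa [ha, hxQ] using this
    · have := hh1 ⟨hx, hxQ⟩
      simpa [hxQ] using this
  · intro a ha
    exact (hg ⟨a, ha⟩).injOn.congr (hQe a ha).symm
  · intro a ha
    exact hh2.congr (hQce a).symm
  · intro a ha b hb hab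
    rw [(hQe a ha).image_eq, (hQe b hb).image_eq, (hg _).image_eq, (hg _).image_eq] at hab
    have := B.injective (Subtype.ext (Finset.coe_injective hab))
    simpa using this

end Components

end SimpleGraph

namespace SimpleGraph

/-! ### The root is a cut vertex, and the induction. -/

section DisconnectedCase

variable {V : Type*} {G : SimpleGraph V}

lemma rich_of_components_of_lt [Finite V] {k N : ℕ} (hk : 0 < k) {S : Set V} {r : V} (hr : r ∈ S)
    (hN : ∀ C ∈ componentsOn G (S \ {r}), Rich G (Fin k) (insert r C) r N)
    {Q : Set (Set V)} (hQ : Q ⊆ componentsOn G (S \ {r})) (hQne : Q.Nonempty)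
    (hQφ : ∀ φ, IsoOn G S S φ → φ r = r → ∀ C ∈ Q, φ '' C ∈ Q)
    (hQN : Q.ncard < N) (hCN : (componentsOn G (S \ {r})).ncard ≤ N) : Rich G (Fin k) S r N := by
  obtain ⟨f, h1, h2, h3, h4⟩ := exists_injOn_family (Set.toFinite _) hQ hQne hQN hCN
  have : Nonempty (Fin k) := ⟨⟨0, hk⟩⟩
  exact rich_of_components hr hN Q hQ hQφ f h1 h2 h3 h4

lemma exists_adj_of_mem_componentsOn {S : Set V} {r : V} (hr : r ∈ S) (hS : ConnOn G S) {C : Set V}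
    (hC : C ∈ componentsOn G (S \ {r})) : ∃ v ∈ C, G.Adj r v := by
  by_contra hcon
  push Not at hcon
  have hCT := subset_of_mem_componentsOn hC
  obtain ⟨u, hu⟩ := (connOn_of_mem_componentsOn hC).1
  have : r ∈ C := hS.mem_of_closed (hCT hu).1 hu (fun a ha b hb hab => by
    by_cases hbr : b = r
    · subst hbr; exact absurd hab.symm (hcon a ha)
    · exact componentsOn_closed hC a ha b ⟨hb, hbr⟩ hab) hr
  exact (hCT this).2 rfl

lemma connOn_insert_of_mem_componentsOn {S : Set V} {r : V} (hr : r ∈ S) (hS : ConnOn G S)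
    {C : Set V} (hC : C ∈ componentsOn G (S \ {r})) : ConnOn G (insert r C) := by
  obtain ⟨v, hv, hrv⟩ := exists_adj_of_mem_componentsOn hr hS hC
  refine connOn_of_root (Set.mem_insert _ _) fun w hw => ?_
  obtain rfl | hw := hw
  · exact .refl _
  · exact (ReachIn.of_adj hrv (Set.mem_insert _ _) (Set.mem_insert_of_mem _ hv)).trans
      (((connOn_of_mem_componentsOn hC).2 v hv w hw).mono (Set.subset_insert _ _))

lemma not_adj_of_mem_componentsOn {T C D : Set V} (hC : C ∈ componentsOn G T)
    (hD : D ∈ componentsOn G T) (hCD : C ≠ D) {u v : V} (hu : u ∈ C) (hv : v ∈ D) :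
    ¬ G.Adj u v := fun h => hCD (componentsOn_eq_of_mem hC hD
  (componentsOn_closed hC u hu v (subset_of_mem_componentsOn hD hv) h) hv)

/-- A choice of one neighbour of the root in each component gives an independent set. -/
lemma exists_transversal [Finite V] {T : Set V} {r : V} (g : Set V → V)
    (hg : ∀ C ∈ componentsOn G T, g C ∈ C ∧ G.Adj r (g C)) :
    ∃ I : Finset V, I.card = (componentsOn G T).ncard ∧ (∀ x, x ∈ I ↔ ∃ C ∈ componentsOn G T, g C = x) ∧
      (∀ x ∈ I, G.Adj r x) ∧ ∀ x ∈ I, ∀ y ∈ I, ¬ G.Adj x y := by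
  classical
  have hmem : ∀ x, x ∈ (Set.toFinite (g '' componentsOn G T)).toFinset ↔
      ∃ C ∈ componentsOn G T, g C = x := fun x => by simp
  refine ⟨_, ?_, hmem, ?_, ?_⟩
  · rw [← Set.ncard_eq_toFinset_card]
    refine Set.InjOn.ncard_image fun C hC D hD hCD => ?_
    have := (hg D hD).1
    rw [← show g C = g D from hCD] at this
    exact componentsOn_eq_of_mem hC hD (hg C hC).1 this
  · intro x hx
    obtain ⟨C, hC, rfl⟩ := (hmem x).1 hx
    exact (hg C hC).2
  · intro x hx y hy
    obtain ⟨C, hC, rfl⟩ := (hmem x).1 hx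
    obtain ⟨D, hD, rfl⟩ := (hmem y).1 hy
    by_cases hCD : C = D
    · subst hCD; exact G.irrefl
    · exact not_adj_of_mem_componentsOn hC hD hCD (hg C hC).1 (hg D hD).1

lemma ncard_componentsOn_le [Finite V] {k : ℕ} (hL : LocallyIndepLE G k) {S : Set V} {r : V}
    (hr : r ∈ S) (hS : ConnOn G S) : (componentsOn G (S \ {r})).ncard ≤ k := by
  have : Nonempty V := ⟨r⟩
  choose! g hg using fun C (hC : C ∈ componentsOn G (S \ {r})) =>
    exists_adj_of_mem_componentsOn hr hS hC
  obtain ⟨I, hI, -, h1, h2⟩ := exists_transversal g hg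
  exact hI ▸ hL r I h1 h2

/-- Two nonadjacent neighbours of r in one component, with one neighbour from each of the other k -
1, would be k + 1 independent neighbours of r. -/
lemma adj_of_ncard_componentsOn [Finite V] {k : ℕ} (hL : LocallyIndepLE G k) {S : Set V} {r : V}
    (hr : r ∈ S) (hS : ConnOn G S) (hk : (componentsOn G (S \ {r})).ncard = k) {C : Set V}
    (hC : C ∈ componentsOn G (S \ {r})) {u v : V} (hu : u ∈ C) (hv : v ∈ C) (hru : G.Adj r u)
    (hrv : G.Adj r v) (huv : u ≠ v) : G.Adj u v := by
  classical
  by_contra hn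
  have : Nonempty V := ⟨r⟩
  choose! g hg using fun C (hC : C ∈ componentsOn G (S \ {r})) =>
    exists_adj_of_mem_componentsOn hr hS hC
  obtain ⟨I, hI, h0, h1, h2⟩ := exists_transversal (Function.update g C u) fun D hD => by
    by_cases hDC : D = C
    · subst hDC; simpa using ⟨hu, hru⟩
    · simpa [hDC] using hg D hD
  have hvI : ∀ x ∈ I, x ≠ v ∧ ¬ G.Adj x v := by
    intro x hx
    obtain ⟨D, hD, rfl⟩ := (h0 x).1 hx
    by_cases hDC : D = C
    · subst hDC; simpa using ⟨huv, hn⟩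
    · rw [Function.update_of_ne hDC]
      refine ⟨fun h => hDC (componentsOn_eq_of_mem hD hC (hg D hD).1 (h ▸ hv)), ?_⟩
      exact not_adj_of_mem_componentsOn hD hC hDC (hg D hD).1 hv
  have := hL r (insert v I) (by
    intro x hx
    rcases Finset.mem_insert.1 hx with rfl | hx'
    · exact hrv
    · exact h1 x hx') (by
    intro x hx y hy
    rcases Finset.mem_insert.1 hx with rfl | hx' <;> rcases Finset.mem_insert.1 hy with rfl | hy'
    · exact G.irrefl
    · exact fun h => (hvI y hy').2 h.symm
    · exact (hvI x hx').2
    · exact h2 x hx' y hy')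
  rw [Finset.card_insert_of_notMem fun h => (hvI v h).1 rfl] at this
  omega

/-- The inductive step for a root that is a cut vertex. -/
lemma rich_or_exceptional_of_not_connOn_diff [Finite V] {k : ℕ} (hk : 2 ≤ k)
    (hL : LocallyIndepLE G k) {S : Set V} {r : V} (hr : r ∈ S) (hS : ConnOn G S) (hne : S ≠ {r})
    (hT : ¬ ConnOn G (S \ {r}))
    (IH : ∀ (S' : Set V) (r' : V), S'.ncard < S.ncard → r' ∈ S' → ConnOn G S' →
      Rich G (Fin k) S' r' k ∨ S' = {r'} ∨ Exceptional G k S' r') :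
    Rich G (Fin k) S r k ∨ Exceptional G k S r := by
  set 𝒞 := componentsOn G (S \ {r}) with h𝒞
  have hfin : 𝒞.Finite := Set.toFinite _
  have h𝒞ne : 𝒞.Nonempty := by
    obtain ⟨u, hu, hur⟩ : ∃ u ∈ S, u ≠ r := by
      by_contra hcon
      push Not at hcon
      exact hne (Set.eq_singleton_iff_unique_mem.2 ⟨hr, hcon⟩)
    obtain ⟨C, hC, -⟩ := exists_mem_componentsOn (G := G) (show u ∈ S \ {r} from ⟨hu, hur⟩)
    exact ⟨C, hC⟩
  have hCT : ∀ C ∈ 𝒞, C ⊆ S \ {r} := fun C hC => subset_of_mem_componentsOn hC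
  have hdiff : ∀ C ∈ 𝒞, insert r C \ {r} = C := fun C hC => by
    have : r ∉ C := fun h => (hCT C hC h).2 rfl
    simp [this]
  have step : ∀ C ∈ 𝒞, _ := fun C hC => by
    have hsub : insert r C ⊂ S := by
      refine ⟨Set.insert_subset hr fun v hv => (hCT C hC hv).1, fun h => hT ?_⟩
      have : S \ {r} = C := Set.Subset.antisymm
        (fun v hv => (h hv.1).resolve_left hv.2) (hCT C hC)
      rw [this]
      exact connOn_of_mem_componentsOn hC
    have hlt : (insert r C).ncard < S.ncard := Set.ncard_lt_ncard hsub
    exact rich_of_connOn_diff hk hL (Set.mem_insert r C)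
      (connOn_insert_of_mem_componentsOn hr hS hC)
      (by rw [hdiff C hC]; exact connOn_of_mem_componentsOn hC)
      fun S' r' h => IH S' r' (h.trans hlt)
  have hk𝒞 : 𝒞.ncard ≤ k := ncard_componentsOn_le hL hr hS
  have h𝒞φ : ∀ φ, IsoOn G S S φ → φ r = r → ∀ C ∈ 𝒞, φ '' C ∈ 𝒞 := fun φ h1 h2 C hC =>
    image_mem_componentsOn (h1.diff_root h2) hC
  rcases hk𝒞.lt_or_eq with hlt | heq
  · exact Or.inl (rich_of_components_of_lt (by omega) hr (fun C hC => (step C hC).1) subset_rfl h𝒞ne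
      h𝒞φ hlt hk𝒞)
  have hclq : ∀ C ∈ 𝒞, ∀ u ∈ C, ∀ v ∈ C, G.Adj r u → G.Adj r v → u ≠ v → G.Adj u v :=
    fun C hC u hu v hv => adj_of_ncard_componentsOn hL hr hS heq hC hu hv
  by_cases hall : ∀ C ∈ 𝒞, Rich G (Fin k) (insert r C) r (k + 1)
  · exact Or.inl ((rich_of_components_of_lt (by omega) hr hall subset_rfl h𝒞ne
      h𝒞φ (Nat.lt_succ_of_le hk𝒞) (Nat.le_succ_of_le hk𝒞)).mono (by omega))
  push Not at hall
  obtain ⟨C₀, hC₀, hnr⟩ := hall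
  have hC₀' := ((step C₀ hC₀).2 (by
    rintro u (rfl | hu) v (rfl | hv) hru hrv huv
    · exact absurd rfl huv
    · exact absurd hru G.irrefl
    · exact absurd hrv G.irrefl
    · exact hclq C₀ hC₀ u hu v hv hru hrv huv)).resolve_left hnr
  rw [hdiff C₀ hC₀] at hC₀'
  -- Size and complete adjacency to r are preserved by rooted automorphisms, so `Q` is invariant. If
  -- `Q` is proper, it has fewer than k members and the count works for it.
  set Q : Set (Set V) := {C | C ∈ 𝒞 ∧ C.ncard = C₀.ncard ∧ ∀ v ∈ C, G.Adj r v} with hQ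
  have hC₀Q : C₀ ∈ Q := by
    refine ⟨hC₀, rfl, ?_⟩
    rcases hC₀' with ⟨a, rfl, ha⟩ | ⟨-, a, b, -, rfl, ha, hb, -⟩
    · rintro v rfl; exact ha
    · rintro v (rfl | rfl) <;> assumption
  by_cases hQ𝒞 : Q = 𝒞
  swap
  · have hss : Q ⊂ 𝒞 := LE.le.ssubset_of_ne (fun C hC => hC.1) hQ𝒞
    refine Or.inl (rich_of_components_of_lt (by omega) hr (fun C hC => (step C hC).1) hss.1
      ⟨C₀, hC₀Q⟩ ?_ ((Set.ncard_lt_ncard hss hfin).trans_le hk𝒞) hk𝒞)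
    rintro φ h1 h2 C ⟨hC, hcard, hadj⟩
    refine ⟨h𝒞φ φ h1 h2 C hC, ?_, ?_⟩
    · rw [Set.ncard_image_of_injective _ φ.injective, hcard]
    · rintro _ ⟨v, hv, rfl⟩
      have := (h1.2 r hr v (hCT C hC hv).1).2 (hadj v hv)
      rwa [h2] at this
  right
  have hQall : ∀ C ∈ 𝒞, C.ncard = C₀.ncard ∧ ∀ v ∈ C, G.Adj r v := fun C hC => by
    rw [← hQ𝒞] at hC; exact hC.2
  have hcomp : ∀ v ∈ S, v ≠ r → ∃ C ∈ 𝒞, v ∈ C := fun v hv hvr => exists_mem_componentsOn ⟨hv, hvr⟩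
  rcases hC₀' with ⟨a, rfl, ha⟩ | ⟨rfl, a, b, hab, rfl, ha, hb, hadj⟩
  · left
    have hsing : ∀ C ∈ 𝒞, ∀ v ∈ C, C = {v} := fun C hC v hv => by
      obtain ⟨w, rfl⟩ := Set.ncard_eq_one.1 ((hQall C hC).1.trans (Set.ncard_singleton a))
      rw [Set.mem_singleton_iff.1 hv]
    refine ⟨?_, ?_, ?_⟩
    · have : 𝒞 = (fun v => ({v} : Set V)) '' (S \ {r}) := by
        ext C
        constructor
        · intro hC
          obtain ⟨v, hv⟩ := (connOn_of_mem_componentsOn hC).1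
          exact ⟨v, hCT C hC hv, (hsing C hC v hv).symm⟩
        · rintro ⟨v, hv, rfl⟩
          obtain ⟨C, hC, hvC⟩ := hcomp v hv.1 hv.2
          change {v} ∈ 𝒞
          rwa [← hsing C hC v hvC]
      rw [← heq, this, Set.ncard_image_of_injective _ Set.singleton_injective]
    · intro v hv hvr
      obtain ⟨C, hC, hvC⟩ := hcomp v hv hvr
      exact (hQall C hC).2 v hvC
    · intro u hu v hv hur hvr huv
      obtain ⟨C, hC, huC⟩ := hcomp u hu hur
      have hvC := componentsOn_closed hC u huC v ⟨hv, hvr⟩ huv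
      rw [hsing C hC u huC] at hvC
      exact huv.ne (Set.mem_singleton_iff.1 hvC).symm
  · refine Or.inr ⟨rfl, ?_⟩
    -- Here k = 2, so there is exactly one other component, again with two vertices, both adjacent
    -- to r.
    obtain ⟨C₁, hC₁, hC₁₀⟩ := Set.exists_ne_of_one_lt_ncard (by omega : 1 < 𝒞.ncard) ({a, b} : Set V)
    have h𝒞2 : 𝒞 = {{a, b}, C₁} := by
      refine (Set.eq_of_subset_of_ncard_le ?_ ?_ hfin).symm
      · rintro C (rfl | rfl) <;> assumption
      · rw [heq, Set.ncard_pair hC₁₀.symm]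
    obtain ⟨c, d, hcd, rfl⟩ := Set.ncard_eq_two.1 ((hQall C₁ hC₁).1.trans (Set.ncard_pair hab))
    have hrc := (hQall _ hC₁).2 c (by simp)
    have hrd := (hQall _ hC₁).2 d (by simp)
    have hcross : ∀ u ∈ ({a, b} : Set V), ∀ v ∈ ({c, d} : Set V), u ≠ v ∧ ¬ G.Adj u v :=
      fun u hu v hv => ⟨fun h => hC₁₀ (componentsOn_eq_of_mem hC₁ hC₀ hv (h ▸ hu)),
        not_adj_of_mem_componentsOn hC₀ hC₁ hC₁₀.symm hu hv⟩
    have hac := hcross a (by simp) c (by simp)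
    have had := hcross a (by simp) d (by simp)
    have hbc := hcross b (by simp) c (by simp)
    have hbd := hcross b (by simp) d (by simp)
    refine ⟨a, b, c, d, hac.1, had.1, hbc.1, hbd.1, ?_, ha, hb, hrc, hrd, hadj,
      hclq _ hC₁ c (by simp) d (by simp) hrc hrd hcd, hac.2, had.2, hbc.2, hbd.2⟩
    ext v
    constructor
    · intro hv
      by_cases hvr : v = r
      · exact Or.inl hvr
      obtain ⟨C, hC, hvC⟩ := hcomp v hv hvr
      rw [h𝒞2] at hC
      rcases hC with rfl | rfl
      · rcases hvC with rfl | rfl <;> simp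
      · rcases hvC with rfl | rfl <;> simp
    · rintro (rfl | rfl | rfl | rfl | rfl)
      · exact hr
      · exact (hCT _ hC₀ (by simp)).1
      · exact (hCT _ hC₀ (by simp)).1
      · exact (hCT _ hC₁ (by simp)).1
      · exact (hCT _ hC₁ (by simp)).1

theorem rich_or_exceptional [Finite V] {k : ℕ} (hk : 2 ≤ k) (hL : LocallyIndepLE G k) (S : Set V)
    (r : V) (hr : r ∈ S) (hS : ConnOn G S) :
    Rich G (Fin k) S r k ∨ S = {r} ∨ Exceptional G k S r := by
  induction h : S.ncard using Nat.strong_induction_on generalizing S r with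
  | _ m ih =>
    subst h
    have IH : ∀ (S' : Set V) (r' : V), S'.ncard < S.ncard → r' ∈ S' → ConnOn G S' →
        Rich G (Fin k) S' r' k ∨ S' = {r'} ∨ Exceptional G k S' r' :=
      fun S' r' hlt hr' hS' => ih _ hlt S' r' hr' hS' rfl
    by_cases hT : ConnOn G (S \ {r})
    · exact Or.inl (rich_of_connOn_diff hk hL hr hS hT IH).1
    · by_cases hne : S = {r}
      · exact Or.inr (Or.inl hne)
      · exact (rich_or_exceptional_of_not_connOn_diff hk hL hr hS hne hT IH).imp_right Or.inr

end DisconnectedCase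

/-! ### From subsets and permutations back to graphs and isomorphisms. -/

section Translation

variable {V : Type*} {G : SimpleGraph V}

lemma adj_sumElim_iff {k : ℕ} {v : V} {e : Fin k → V} (h1 : ∀ i, G.Adj v (e i))
    (h2 : ∀ i j, ¬ G.Adj (e i) (e j)) (i j : Fin 1 ⊕ Fin k) :
    G.Adj (Sum.elim (fun _ => v) e i) (Sum.elim (fun _ => v) e j) ↔ (starK k).Adj i j := by
  rcases i with i | i <;> rcases j with j | j
  · simp
  · simpa using h1 j
  · simpa using (h1 i).symm
  · simpa using h2 i j

lemma locallyIndepLE_of_isIndFree {k : ℕ} (h : IsIndFree (starK (k + 1)) G) :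
    LocallyIndepLE G k := by
  intro v I h1 h2
  by_contra hcard
  obtain ⟨J, hJI, hJ⟩ := Finset.exists_subset_card_eq (by omega : k + 1 ≤ I.card)
  have e : Fin (k + 1) ≃ J := (Fintype.equivFinOfCardEq (by simpa using hJ)).symm
  have hadj : ∀ i, G.Adj v (e i) := fun i => h1 _ (hJI (e i).2)
  refine h ⟨⟨⟨Sum.elim (fun _ => v) (fun i => (e i : V)), ?_⟩, ?_⟩⟩
  · rintro (i | i) (j | j) hij
    · rw [Subsingleton.elim i j]
    · exact absurd hij (hadj j).ne
    · exact absurd hij.symm (hadj i).ne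
    · rw [e.injective (Subtype.ext hij)]
  · exact adj_sumElim_iff hadj (fun i j => h2 _ (hJI (e i).2) _ (hJI (e j).2)) _ _

lemma connOn_univ (h : G.Connected) (r : V) : ConnOn G Set.univ := by
  refine connOn_of_root (Set.mem_univ r) fun v _ => ?_
  obtain ⟨p⟩ := h.preconnected r v
  induction p with
  | nil => exact .refl _
  | cons hadj _ ih => exact (ReachIn.of_adj hadj (Set.mem_univ _) (Set.mem_univ _)).trans (ih trivial)

/-- Rigidity with i = j says that a colouring is distinguishing, and with i ≠ j that two colourings
are non-isomorphic. -/
lemma exists_colorings_of_rich {r : V} {k : ℕ} (h : Rich G (Fin k) Set.univ r k) :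
    ∃ c : Fin k → G.EdgeLabeling (Fin k), (∀ i, IsDistinguishing r (c i)) ∧
      ∀ i j, i ≠ j → NonIsomorphic r (c i) (c j) := by
  obtain ⟨c, hc⟩ := h
  have iso : ∀ φ : G ≃g G, IsoOn G Set.univ Set.univ φ.toEquiv := fun φ =>
    ⟨fun _ => by simp, fun u _ v _ => φ.map_adj_iff⟩
  refine ⟨fun i e => c i e.1, fun i φ hφ hφc => ?_, fun i j hij φ hφ => ?_⟩
  · have := (hc i i.2 i i.2 φ.toEquiv (iso φ) hφ
      fun u _ v _ huv => hφc ⟨s(u, v), huv⟩).2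
    ext v
    exact this v trivial
  · by_contra hcon
    push Not at hcon
    exact hij (Fin.ext (hc i i.2 j j.2 φ.toEquiv (iso φ) hφ
      fun u _ v _ huv => (hcon ⟨s(u, v), huv⟩).symm).1)

lemma StarAt.exists_iso [Finite V] {k : ℕ} {r : V} (h : StarAt G k Set.univ r) :
    ∃ f : G ≃g starK k, f r = Sum.inl 0 := by
  obtain ⟨h1, h2, h3⟩ := h
  have hk : Nat.card ↥(Set.univ \ {r} : Set V) = k := h1
  have e : Fin k ≃ ↥(Set.univ \ {r} : Set V) := (Finite.equivFinOfCardEq hk).symm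
  have hne : ∀ i, (e i : V) ≠ r := fun i => (e i).2.2
  have hadj : ∀ i, G.Adj r (e i) := fun i => h2 _ trivial (hne i)
  let g : Fin 1 ⊕ Fin k ≃ V := Equiv.ofBijective (Sum.elim (fun _ => r) (fun i => (e i : V))) (by
    constructor
    · rintro (i | i) (j | j) hij
      · rw [Subsingleton.elim i j]
      · exact absurd hij.symm (hne j)
      · exact absurd hij (hne i)
      · rw [e.injective (Subtype.ext hij)]
    · intro v
      by_cases hv : v = r
      · exact ⟨Sum.inl 0, hv.symm⟩
      · exact ⟨Sum.inr (e.symm ⟨v, trivial, hv⟩), by simp⟩)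
  let f : starK k ≃g G := ⟨g, adj_sumElim_iff hadj (fun i j => h3 _ trivial _ trivial (hne i) (hne j)) _ _⟩
  exact ⟨f.symm, f.symm_apply_eq.2 rfl⟩

lemma HourglassAt.exists_iso {r : V} (h : HourglassAt G Set.univ r) :
    ∃ f : G ≃g hourglass, f r = 0 := by
  obtain ⟨a, b, c, d, hac, had, hbc, hbd, hS, ra, rb, rc, rd, ab, cd, nac, nad, nbc, nbd⟩ := h
  let g : Fin 5 ≃ V := Equiv.ofBijective ![r, a, b, c, d] (by
    constructor
    · intro i j hij
      fin_cases i <;> fin_cases j <;>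
        simp [hac, had, hbc, hbd, ra.ne, rb.ne, rc.ne, rd.ne, ab.ne, cd.ne, hac.symm, had.symm,
          hbc.symm, hbd.symm, ra.ne', rb.ne', rc.ne', rd.ne', ab.ne', cd.ne'] at hij ⊢
    · intro v
      have : v ∈ ({r, a, b, c, d} : Set V) := hS ▸ trivial
      rcases this with rfl | rfl | rfl | rfl | rfl
      exacts [⟨0, rfl⟩, ⟨1, rfl⟩, ⟨2, rfl⟩, ⟨3, rfl⟩, ⟨4, rfl⟩])
  have hg : ∀ i j, G.Adj (![r, a, b, c, d] i) (![r, a, b, c, d] j) ↔ hourglass.Adj i j := by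
    intro i j
    fin_cases i <;> fin_cases j <;>
      simp [hourglass, ra, rb, rc, rd, ab, cd, nac, nad, nbc, nbd, ra.symm, rb.symm, rc.symm,
        rd.symm, ab.symm, cd.symm, G.adj_comm c a, G.adj_comm d a, G.adj_comm c b, G.adj_comm d b]
  let f : hourglass ≃g G := ⟨g, hg _ _⟩
  exact ⟨f.symm, f.symm_apply_eq.2 rfl⟩

lemma nonempty_iso_of_univ_eq_singleton {r : V} (h : (Set.univ : Set V) = {r}) :
    Nonempty (G ≃g completeGraph (Fin 1)) := by
  have hr : ∀ v, v = r := fun v => (h ▸ trivial : v ∈ ({r} : Set V))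
  have : Unique V := ⟨⟨r⟩, hr⟩
  refine ⟨⟨Equiv.ofUnique V (Fin 1), fun {u v} => ?_⟩⟩
  rw [hr u, hr v]
  simp

end Translation

end SimpleGraph

theorem theorem3 {V : Type*} [Finite V] (G : SimpleGraph V) (n : ℕ) (hn : 2 < n)
    (hconn : G.Connected) (hfree : SimpleGraph.IsIndFree (SimpleGraph.starK n) G) (r : V) :
    (∃ c : Fin (n - 1) → G.EdgeLabeling (Fin (n - 1)),
      (∀ i, SimpleGraph.IsDistinguishing r (c i)) ∧
      (∀ i j, i ≠ j → SimpleGraph.NonIsomorphic r (c i) (c j))) ∨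
    (n = 3 ∧ ∃ f : G ≃g SimpleGraph.hourglass, f r = 0) ∨
    (∃ f : G ≃g SimpleGraph.starK (n - 1), f r = Sum.inl 0) ∨
    Nonempty (G ≃g SimpleGraph.completeGraph (Fin 1)) := by
  obtain ⟨k, rfl⟩ : ∃ k, n = k + 1 := ⟨n - 1, by omega⟩
  rw [Nat.add_sub_cancel]
  have hk : 2 ≤ k := by omega
  rcases SimpleGraph.rich_or_exceptional hk (SimpleGraph.locallyIndepLE_of_isIndFree hfree) Set.univ
    r trivial (SimpleGraph.connOn_univ hconn r) with h | h | h | ⟨rfl, h⟩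
  · exact Or.inl (SimpleGraph.exists_colorings_of_rich h)
  · exact Or.inr (Or.inr (Or.inr (SimpleGraph.nonempty_iso_of_univ_eq_singleton h)))
  · exact Or.inr (Or.inr (Or.inl h.exists_iso))
  · exact Or.inr (Or.inl ⟨rfl, h.exists_iso⟩)
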